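/- A stable plane is a pair $(M,\mathcal L)$ consisting of a set $M$ of points and a set $\mathcal L$ of subsets of $M$, called lines, each containing at least two points, such that any two distinct points lie on a unique common line, together with locally compact Hausdorff topologies of positive topological dimension (small inductive dimension) on both $M$ and $\mathcal L$ such that: the join map, sending a pair of distinct points to the line joining them, is continuous; the set of pairs of distinct intersecting lines is open in $\mathcal L\times\mathcal L$, and the map sending such a pair to its point of intersection is continuous; and there are four distinct points no three of which are on one line. A line is projective if it meets every other line. A line is pointwise coaffine if it is not projective and, among the lines different from it, it meets exactly the projective ones. A (topological) projective plane is a stable plane in which any two lines intersect. A punctured projective plane is a plane isomorphic to the one obtained from a projective plane $(P,\mathcal K)$ by deleting one point $o$: the points are the elements of $P\setminus\{o\}$ with the subspace topology, the lines are the sets $K\setminus\{o\}$, $K\in\mathcal K$, topologized via the bijection with $\mathcal K$; isomorphisms are incidence-preserving pairs of homeomorphisms of the point spaces and of the line spaces. **Proposition 1.3.** If every line of a stable plane is either projective or pointwise coaffine, then the plane is either a projective plane or a punctured projective plane. Conversely, every projective plane and every punctured projective plane is a stable plane in which every line is either projective or pointwise coaffine. -/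

import Mathlib

open Set

universe u

/-- A stable plane: a point set `M` and a set `𝓛` of subsets of `M` (the lines), both carrying
locally compact Hausdorff topologies of positive topological dimension, such that any two distinct
points are joined by a unique line, joining is continuous, intersection of pairs of distinct
intersecting lines is continuous with open domain, and there is a quadrangle. As in every linear
space, a line contains at least two points. -/
structure IsStablePlane {M : Type u} [TopologicalSpace M] (𝓛 : Set (Set M))
    [TopologicalSpace 𝓛] : Prop where
  nontrivial_line : ∀ L ∈ 𝓛, L.Nontrivial
  existsUnique_line : ∀ p q : M, p ≠ q → ∃! L : Set M, L ∈ 𝓛 ∧ p ∈ L ∧ q ∈ L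
  t2_points : T2Space M
  t2_lines : T2Space 𝓛
  locallyCompact_points : LocallyCompactSpace M
  locallyCompact_lines : LocallyCompactSpace 𝓛
  dim_points_pos : 0 < smallInductiveDimension M
  dim_lines_pos : 0 < smallInductiveDimension 𝓛
  /-- The join operation, which is determined by its values on pairs of distinct points, is
  continuous. -/
  continuous_join : ∃ join : {x : M × M // x.1 ≠ x.2} → 𝓛, Continuous join ∧
    ∀ x, x.1.1 ∈ (join x).1 ∧ x.1.2 ∈ (join x).1
  /-- Stability of intersection. -/
  isOpen_meet_domain : IsOpen {x : 𝓛 × 𝓛 | x.1 ≠ x.2 ∧ (x.1.1 ∩ x.2.1).Nonempty}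
  /-- The intersection operation, which is determined on pairs of distinct intersecting lines, is
  continuous. -/
  continuous_meet : ∃ meet : {x : 𝓛 × 𝓛 // x.1 ≠ x.2 ∧ (x.1.1 ∩ x.2.1).Nonempty} → M,
    Continuous meet ∧ ∀ x, meet x ∈ x.1.1.1 ∧ meet x ∈ x.1.2.1
  quadrangle : ∃ q : Fin 4 → M, Function.Injective q ∧ ∀ L ∈ 𝓛, ∀ i j k : Fin 4,
    i ≠ j → i ≠ k → j ≠ k → ¬ (q i ∈ L ∧ q j ∈ L ∧ q k ∈ L)

/-- A line `L` is projective if it meets every other line. -/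
def IsProjectiveLine {M : Type u} (𝓛 : Set (Set M)) (L : Set M) : Prop :=
  ∀ K ∈ 𝓛, K ≠ L → (L ∩ K).Nonempty

/-- A line `L` is pointwise coaffine if it is not projective and, among the other lines, meets
exactly the projective ones. -/
def IsPointwiseCoaffineLine {M : Type u} (𝓛 : Set (Set M)) (L : Set M) : Prop :=
  ¬ IsProjectiveLine 𝓛 L ∧ ∀ K ∈ 𝓛, K ≠ L → ((L ∩ K).Nonempty ↔ IsProjectiveLine 𝓛 K)

/-- A (topological) projective plane: a stable plane in which any two lines intersect. -/
def IsProjectivePlane {M : Type u} [TopologicalSpace M] (𝓛 : Set (Set M))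
    [TopologicalSpace 𝓛] : Prop :=
  IsStablePlane 𝓛 ∧ ∀ K ∈ 𝓛, ∀ L ∈ 𝓛, (K ∩ L).Nonempty

/-- A punctured projective plane: up to isomorphism of topological planes, a topological projective
plane `(P, 𝓚)` with one point `o` deleted. The points are the points of `P` other than `o`, with
the subspace topology; the lines are the traces of the members of `𝓚`, topologized as `𝓚`. -/
def IsPuncturedProjectivePlane {M : Type u} [TopologicalSpace M] (𝓛 : Set (Set M))
    [TopologicalSpace 𝓛] : Prop :=
  ∃ (P : Type u) (_ : TopologicalSpace P) (𝓚 : Set (Set P)) (_ : TopologicalSpace 𝓚) (o : P),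
    IsProjectivePlane 𝓚 ∧
    ∃ (e : M ≃ₜ {x : P // x ≠ o}) (f : 𝓛 ≃ₜ 𝓚),
      ∀ (p : M) (L : 𝓛), p ∈ L.1 ↔ (e p).1 ∈ (f L).1

/-! If all lines are projective, any two lines meet. Otherwise there is a nonprojective line, and
coaffinity makes distinct nonprojective lines disjoint; the forward direction uses nothing more
(`HasDisjointNonprojectiveLines`).

Positive dimension supplies a nontrivial connected set, and perspectivities spread connectedness to
all projective lines and all pencils. A connected projective line through `o` must cross the compact
boundary of a small neighbourhood of `o`; hence pencils, projective lines and finally the line space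
are compact. The decisive lemma `exists_nonprojective_mem` plays compactness against connectedness
of pencils to show that the nonprojective lines cover the point set. They thus form a parallel
class, and the point at infinity of `OnePoint M`, put on each of them, completes the plane.
Incidence in the completion is closed and both spaces are compact Hausdorff, so joining and meeting
are automatically continuous.

Conversely, deleting a point `o` from a projective plane preserves the axioms; the lines through `o`
become coaffine and the others stay projective. -/

/-! ### Dimension, connectedness and closed graphs -/

theorem isTopologicalBasis_isClopen_iff_totallyDisconnectedSpace (X : Type u) [TopologicalSpace X]
    [T2Space X] [LocallyCompactSpace X] :
    TopologicalSpace.IsTopologicalBasis {s : Set X | IsClopen s} ↔ TotallyDisconnectedSpace X := by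
  constructor
  · intro h
    have := totallySeparatedSpace_of_t0_of_basis_clopen h
    infer_instance
  · intro h
    exact loc_compact_Haus_tot_disc_of_zero_dim

theorem smallInductiveDimension_pos_iff (X : Type u) [TopologicalSpace X]
    [T2Space X] [LocallyCompactSpace X] :
    0 < smallInductiveDimension X ↔ ¬ TotallyDisconnectedSpace X := by
  rw [← isTopologicalBasis_isClopen_iff_totallyDisconnectedSpace,
    ← hasSmallInductiveDimensionLT_one_iff, ← not_le]
  exact not_congr (smallInductiveDimension_le_iff (n := 0))

/-- The form in which positive dimension is used: a nontrivial connected set can be shrunk,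
projected and pushed forward. -/
theorem smallInductiveDimension_pos_iff_exists (X : Type u) [TopologicalSpace X]
    [T2Space X] [LocallyCompactSpace X] :
    0 < smallInductiveDimension X ↔ ∃ C : Set X, IsPreconnected C ∧ C.Nontrivial := by
  rw [smallInductiveDimension_pos_iff]
  constructor
  · intro h
    by_contra! h'
    exact h ⟨fun t _ ht => h' t ht⟩
  · rintro ⟨C, hC, hC'⟩ h
    exact hC'.not_subsingleton (h.isTotallyDisconnected_univ C (subset_univ _) hC)

theorem smallInductiveDimension_pos_of_homeomorph {X Y : Type u} [TopologicalSpace X]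
    [TopologicalSpace Y] [T2Space X] [LocallyCompactSpace X] [T2Space Y] [LocallyCompactSpace Y]
    (e : X ≃ₜ Y) (h : 0 < smallInductiveDimension X) : 0 < smallInductiveDimension Y := by
  rw [smallInductiveDimension_pos_iff_exists] at h ⊢
  obtain ⟨C, hC, hC'⟩ := h
  exact ⟨e '' C, hC.image _ e.continuous.continuousOn, hC'.image e.injective⟩

/-- In a compact Hausdorff space, a trivial component has arbitrarily small clopen
neighbourhoods. -/
theorem exists_isClopen_of_connectedComponent_eq {X : Type u} [TopologicalSpace X] [T2Space X]
    [CompactSpace X] {x : X} (hx : connectedComponent x = {x}) {U : Set X} (hU : IsOpen U)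
    (hxU : x ∈ U) : ∃ V, IsClopen V ∧ x ∈ V ∧ V ⊆ U := by
  rw [connectedComponent_eq_iInter_isClopen] at hx
  have hne : Nonempty {s : Set X // IsClopen s ∧ x ∈ s} := ⟨⟨univ, isClopen_univ, mem_univ _⟩⟩
  have hdir : Directed (fun a b : Set X => a ⊇ b)
      fun s : {s : Set X // IsClopen s ∧ x ∈ s} => s.1 := by
    intro s t
    exact ⟨⟨s.1 ∩ t.1, s.2.1.inter t.2.1, s.2.2, t.2.2⟩, inter_subset_left, inter_subset_right⟩
  obtain ⟨V, hV⟩ := exists_subset_nhds_of_compactSpace hdir (fun s => s.2.1.isClosed)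
    (U := U) (fun y hy => by
      rw [hx, mem_singleton_iff] at hy
      exact hy ▸ hU.mem_nhds hxU)
  exact ⟨V.1, V.2.1, V.2.2, hV⟩

/-- In a locally compact Hausdorff space, a point with nontrivial component lies in arbitrarily
small nontrivial connected sets. -/
theorem IsPreconnected.exists_nontrivial_subset {X : Type u} [TopologicalSpace X] [T2Space X]
    [LocallyCompactSpace X] {C : Set X} (hC : IsPreconnected C) {x y : X} (hx : x ∈ C)
    (hy : y ∈ C) (hxy : x ≠ y) {U : Set X} (hU : IsOpen U) (hxU : x ∈ U) :
    ∃ D ⊆ U, IsPreconnected D ∧ x ∈ D ∧ D.Nontrivial := by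
  obtain ⟨N, hN, hNU, hNc⟩ := local_compact_nhds
    ((hU.inter isOpen_compl_singleton).mem_nhds ⟨hxU, hxy⟩ : U ∩ {y}ᶜ ∈ nhds x)
  have hxN : x ∈ interior N := mem_interior_iff_mem_nhds.2 hN
  have : CompactSpace N := isCompact_iff_compactSpace.1 hNc
  let x' : N := ⟨x, interior_subset hxN⟩
  by_cases hcomp : connectedComponent x' = {x'}
  -- A clopen `V` of `N` inside the interior of `N` is clopen in `X`, so it would contain all of
  -- `C`, including `y`, which `N` avoids.
  · exfalso
    obtain ⟨V, hV, hxV, hVN⟩ := exists_isClopen_of_connectedComponent_eq hcomp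
      (isOpen_interior.preimage continuous_subtype_val : IsOpen ((↑) ⁻¹' interior N : Set N)) hxN
    have hcl : IsClosed ((↑) '' V : Set X) :=
      (hV.isClosed.isCompact.image continuous_subtype_val).isClosed
    have hop : IsOpen ((↑) '' V : Set X) := by
      obtain ⟨O, hO, rfl⟩ := isOpen_induced_iff.1 hV.isOpen
      have : ((↑) '' ((↑) ⁻¹' O : Set N) : Set X) = O ∩ interior N := by
        ext z
        constructor
        · rintro ⟨w, hw, rfl⟩
          exact ⟨hw, hVN hw⟩
        · rintro ⟨h1, h2⟩
          exact ⟨⟨z, interior_subset h2⟩, h1, rfl⟩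
      rw [this]
      exact hO.inter isOpen_interior
    obtain ⟨w, -, hw⟩ := hC.subset_isClopen ⟨hcl, hop⟩ ⟨x, hx, x', hxV, rfl⟩ hy
    exact (hNU w.2).2 hw
  · refine ⟨(↑) '' connectedComponent x', ?_, ?_, ⟨x', mem_connectedComponent, rfl⟩, ?_⟩
    · rintro _ ⟨w, -, rfl⟩
      exact (hNU w.2).1
    · exact isPreconnected_connectedComponent.image _ continuous_subtype_val.continuousOn
    · refine Set.Nontrivial.image ?_ Subtype.val_injective
      by_contra hs
      exact hcomp ((not_nontrivial_iff.1 hs).eq_singleton_of_mem mem_connectedComponent)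

/-- Otherwise the interior of `N` and the complement of its closure would separate `C`. -/
theorem IsPreconnected.inter_frontier_nonempty_of_mem {X : Type u} [TopologicalSpace X]
    {C N : Set X} (hC : IsPreconnected C) {x y : X} (hx : x ∈ C) (hxN : x ∈ interior N)
    (hy : y ∈ C) (hyN : y ∉ closure N) : (C ∩ frontier N).Nonempty := by
  by_contra h
  obtain ⟨z, -, hz1, hz2⟩ := hC (interior N) (closure N)ᶜ isOpen_interior
    isClosed_closure.isOpen_compl (by
      intro z hz
      by_cases hzN : z ∈ closure N
      · exact Or.inl (by_contra fun h' => h ⟨z, hz, hzN, h'⟩)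
      · exact Or.inr hzN) ⟨x, hx, hxN⟩ ⟨y, hy, hyN⟩
  exact hz2 (interior_subset_closure hz1)

/-- The preimage of a closed `F` is the projection of the closed set `graph ∩ (X × F)` along the
compact factor `Y`. -/
theorem continuous_of_isClosed_graph_of_compactSpace {X Y : Type*} [TopologicalSpace X]
    [TopologicalSpace Y] [CompactSpace Y] {f : X → Y}
    (h : IsClosed {z : X × Y | f z.1 = z.2}) : Continuous f := by
  refine continuous_iff_isClosed.2 fun F hF => ?_
  convert isClosedMap_fst_of_compactSpace _ (h.inter (hF.preimage continuous_snd)) using 1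
  ext x
  constructor
  · intro hx
    exact ⟨(x, f x), ⟨rfl, hx⟩, rfl⟩
  · rintro ⟨⟨a, b⟩, ⟨h1, h2⟩, rfl⟩
    simp only [mem_ofPred_eq, mem_preimage] at h1 h2 ⊢
    rwa [h1]

/-! ### Join, meet and incidence in a stable plane -/

namespace IsStablePlane

variable {M : Type u} [TopologicalSpace M] {𝓛 : Set (Set M)} [TopologicalSpace 𝓛]

theorem eq_of_mem (h : IsStablePlane 𝓛) {K L : 𝓛} {p q : M} (hpq : p ≠ q) (h1 : p ∈ K.1)
    (h2 : q ∈ K.1) (h3 : p ∈ L.1) (h4 : q ∈ L.1) : K = L :=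
  Subtype.ext ((h.existsUnique_line p q hpq).unique ⟨K.2, h1, h2⟩ ⟨L.2, h3, h4⟩)

theorem point_eq_of_mem (h : IsStablePlane 𝓛) {K L : 𝓛} {p q : M} (hKL : K ≠ L) (h1 : p ∈ K.1)
    (h2 : q ∈ K.1) (h3 : p ∈ L.1) (h4 : q ∈ L.1) : p = q :=
  by_contra fun hpq => hKL (h.eq_of_mem hpq h1 h2 h3 h4)

theorem exists_join (h : IsStablePlane 𝓛) : ∃ j : M → M → 𝓛,
    ContinuousOn (fun x : M × M => j x.1 x.2) {x | x.1 ≠ x.2} ∧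
    ∀ p q, p ≠ q → p ∈ (j p q).1 ∧ q ∈ (j p q).1 := by
  classical
  obtain ⟨j, hj, hj'⟩ := h.continuous_join
  obtain ⟨q, hq, -⟩ := h.quadrangle
  have hq01 : q 0 ≠ q 1 := fun e => absurd (hq e) (by decide)
  refine ⟨fun a b => if hab : a ≠ b then j ⟨(a, b), hab⟩ else j ⟨(q 0, q 1), hq01⟩, ?_, ?_⟩
  · rw [continuousOn_iff_continuous_domRestrict]
    refine hj.congr fun x => ?_
    simp only [domRestrict_apply]
    rw [dif_pos (show x.1.1 ≠ x.1.2 from x.2)]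
  · intro a b hab
    simp only [dif_pos hab]
    exact hj' ⟨(a, b), hab⟩

theorem exists_meet (h : IsStablePlane 𝓛) : ∃ m : 𝓛 → 𝓛 → M,
    ContinuousOn (fun x : 𝓛 × 𝓛 => m x.1 x.2) {x | x.1 ≠ x.2 ∧ (x.1.1 ∩ x.2.1).Nonempty} ∧
    ∀ K L, K ≠ L → (K.1 ∩ L.1).Nonempty → m K L ∈ K.1 ∧ m K L ∈ L.1 := by
  classical
  obtain ⟨m, hm, hm'⟩ := h.continuous_meet
  obtain ⟨q, hq, -⟩ := h.quadrangle
  refine ⟨fun a b => if hab : a ≠ b ∧ (a.1 ∩ b.1).Nonempty then m ⟨(a, b), hab⟩ else q 0, ?_, ?_⟩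
  · rw [continuousOn_iff_continuous_domRestrict]
    refine hm.congr fun x => ?_
    simp only [domRestrict_apply]
    rw [dif_pos (show x.1.1 ≠ x.1.2 ∧ (x.1.1.1 ∩ x.1.2.1).Nonempty from x.2)]
  · intro a b hab hab'
    simp only [dif_pos (show a ≠ b ∧ (a.1 ∩ b.1).Nonempty from ⟨hab, hab'⟩)]
    exact hm' ⟨(a, b), hab, hab'⟩

/-- The line joining two points; a junk value if they coincide. -/
noncomputable def join (h : IsStablePlane 𝓛) : M → M → 𝓛 := h.exists_join.choose

/-- The intersection point of two lines; a junk value if they coincide or are disjoint. -/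
noncomputable def meet (h : IsStablePlane 𝓛) : 𝓛 → 𝓛 → M := h.exists_meet.choose

theorem continuousOn_join (h : IsStablePlane 𝓛) :
    ContinuousOn (fun x : M × M => h.join x.1 x.2) {x | x.1 ≠ x.2} :=
  h.exists_join.choose_spec.1

theorem continuousOn_meet (h : IsStablePlane 𝓛) :
    ContinuousOn (fun x : 𝓛 × 𝓛 => h.meet x.1 x.2)
      {x | x.1 ≠ x.2 ∧ (x.1.1 ∩ x.2.1).Nonempty} :=
  h.exists_meet.choose_spec.1

theorem left_mem_join (h : IsStablePlane 𝓛) {p q : M} (hpq : p ≠ q) : p ∈ (h.join p q).1 :=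
  (h.exists_join.choose_spec.2 p q hpq).1

theorem right_mem_join (h : IsStablePlane 𝓛) {p q : M} (hpq : p ≠ q) : q ∈ (h.join p q).1 :=
  (h.exists_join.choose_spec.2 p q hpq).2

theorem join_eq (h : IsStablePlane 𝓛) {p q : M} (hpq : p ≠ q) {L : 𝓛} (hp : p ∈ L.1)
    (hq : q ∈ L.1) : h.join p q = L :=
  h.eq_of_mem hpq (h.left_mem_join hpq) (h.right_mem_join hpq) hp hq

theorem meet_eq (h : IsStablePlane 𝓛) {K L : 𝓛} (hKL : K ≠ L) {p : M} (hK : p ∈ K.1)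
    (hL : p ∈ L.1) : h.meet K L = p :=
  have := h.exists_meet.choose_spec.2 K L hKL ⟨p, hK, hL⟩
  h.point_eq_of_mem hKL this.1 hK this.2 hL

theorem continuousOn_join_left (h : IsStablePlane 𝓛) (p : M) :
    ContinuousOn (h.join p) {p}ᶜ :=
  h.continuousOn_join.comp (f := fun q : M => (p, q)) (Continuous.continuousOn (by fun_prop))
    fun _ hq => Ne.symm hq

theorem continuousOn_meet_right (h : IsStablePlane 𝓛) (L : 𝓛) :
    ContinuousOn (fun K => h.meet K L) {K | K ≠ L ∧ (K.1 ∩ L.1).Nonempty} :=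
  h.continuousOn_meet.comp (f := fun K : 𝓛 => (K, L)) (Continuous.continuousOn (by fun_prop))
    fun _ hq => hq

theorem exists_notMem (h : IsStablePlane 𝓛) (L : 𝓛) : ∃ p, p ∉ L.1 := by
  obtain ⟨q, hq, hq'⟩ := h.quadrangle
  by_contra! H
  exact hq' L.1 L.2 0 1 2 (by decide) (by decide) (by decide) ⟨H _, H _, H _⟩

theorem exists_mem_ne (h : IsStablePlane 𝓛) (L : 𝓛) (p : M) : ∃ q ∈ L.1, q ≠ p :=
  (h.nontrivial_line L.1 L.2).exists_ne p

/-- Let flags `(p', L')` tend to `(p, L)` with `p` off `L`. For `x` on `L` and `K` the line `px`,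
the points `L' ∩ K` tend to `x`, so `L'`, being the join of `p'` with that point, tends to `K`.
Since `K ≠ L`, this contradicts uniqueness of limits. -/
theorem isClosed_flags (h : IsStablePlane 𝓛) : IsClosed {x : M × 𝓛 | x.1 ∈ x.2.1} := by
  have := h.t2_points
  have := h.t2_lines
  refine isClosed_iff_ultrafilter.2 ?_
  rintro ⟨p, L⟩ g hg hgF
  by_contra hpL
  simp only [mem_ofPred_eq] at hpL
  obtain ⟨x, hx, -⟩ := h.exists_mem_ne L p
  have hpx : p ≠ x := fun e => hpL (e ▸ hx)
  set K := h.join p x with hK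
  have hLK : L ≠ K := fun e => hpL (e ▸ h.left_mem_join hpx)
  have hmeet : h.meet L K = x := h.meet_eq hLK hx (h.right_mem_join hpx)
  have hdom : {K' | K' ≠ K ∧ (K'.1 ∩ K.1).Nonempty} ∈ nhds L :=
    (h.isOpen_meet_domain.preimage (f := fun K' : 𝓛 => (K', K)) (by fun_prop)).mem_nhds
      ⟨hLK, x, hx, h.right_mem_join hpx⟩
  have hp : Filter.Tendsto (fun y : M × 𝓛 => y.1) g (nhds p) :=
    (continuous_fst.tendsto (p, L)).mono_left hg
  have hL : Filter.Tendsto (fun y : M × 𝓛 => y.2) g (nhds L) :=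
    (continuous_snd.tendsto (p, L)).mono_left hg
  have hm : Filter.Tendsto (fun y : M × 𝓛 => h.meet y.2 K) g (nhds x) := by
    have := ((h.continuousOn_meet_right K).continuousAt hdom).tendsto
    rw [hmeet] at this
    exact this.comp hL
  have hj : Filter.Tendsto (fun y : M × 𝓛 => h.join y.1 (h.meet y.2 K)) g (nhds K) := by
    have hopen : {y : M × M | y.1 ≠ y.2} ∈ nhds (p, x) :=
      (isOpen_ne_fun continuous_fst continuous_snd).mem_nhds hpx
    exact (h.continuousOn_join.continuousAt hopen).tendsto.comp (hp.prodMk_nhds hm)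
  have hne : ∀ᶠ y : M × 𝓛 in g, y.1 ≠ h.meet y.2 K :=
    (hp.prodMk_nhds hm).eventually ((isOpen_ne_fun continuous_fst continuous_snd).mem_nhds hpx)
  have heq : ∀ᶠ y : M × 𝓛 in g, h.join y.1 (h.meet y.2 K) = y.2 := by
    filter_upwards [hne, hL hdom, hgF] with y h1 h2 h3
    obtain ⟨z, hz1, hz2⟩ := h2.2
    have hz : h.meet y.2 K = z := h.meet_eq h2.1 hz1 hz2
    exact h.join_eq h1 h3 (hz ▸ hz1)
  exact hLK (tendsto_nhds_unique hL (hj.congr' heq))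

theorem isClosed_line (h : IsStablePlane 𝓛) (L : 𝓛) : IsClosed L.1 :=
  h.isClosed_flags.preimage (f := fun p : M => (p, L)) (by fun_prop)

theorem isClosed_pencil (h : IsStablePlane 𝓛) (p : M) : IsClosed {L : 𝓛 | p ∈ L.1} :=
  h.isClosed_flags.preimage (f := fun L : 𝓛 => (p, L)) (by fun_prop)

end IsStablePlane

/-! ### A compactness criterion for topological projective planes -/

/-- Compact Hausdorff point and line spaces with closed incidence relation make any two operations
of joining and meeting continuous. -/
theorem isProjectivePlane_of_isClosed_flags {P : Type u} [TopologicalSpace P] {𝓚 : Set (Set P)}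
    [TopologicalSpace 𝓚] [CompactSpace P] [T2Space P] [CompactSpace 𝓚] [T2Space 𝓚]
    (hF : IsClosed {x : P × 𝓚 | x.1 ∈ x.2.1})
    (hline : ∀ L ∈ 𝓚, L.Nontrivial)
    (hjoin : ∀ p q : P, p ≠ q → ∃! L : Set P, L ∈ 𝓚 ∧ p ∈ L ∧ q ∈ L)
    (hmeet : ∀ K ∈ 𝓚, ∀ L ∈ 𝓚, (K ∩ L).Nonempty)
    (hP : 0 < smallInductiveDimension P) (hK : 0 < smallInductiveDimension 𝓚)
    (hquad : ∃ q : Fin 4 → P, Function.Injective q ∧ ∀ L ∈ 𝓚, ∀ i j k : Fin 4,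
      i ≠ j → i ≠ k → j ≠ k → ¬ (q i ∈ L ∧ q j ∈ L ∧ q k ∈ L)) : IsProjectivePlane 𝓚 := by
  refine ⟨⟨hline, hjoin, inferInstance, inferInstance, inferInstance, inferInstance, hP, hK,
    ?_, ?_, ?_, hquad⟩, hmeet⟩
  · have hj : ∀ x : {x : P × P // x.1 ≠ x.2}, ∃ L : 𝓚, x.1.1 ∈ L.1 ∧ x.1.2 ∈ L.1 := fun x =>
      let ⟨L, hL, _⟩ := hjoin _ _ x.2
      ⟨⟨L, hL.1⟩, hL.2⟩
    choose j hj using hj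
    refine ⟨j, continuous_of_isClosed_graph_of_compactSpace ?_, hj⟩
    have : {z : {x : P × P // x.1 ≠ x.2} × 𝓚 | j z.1 = z.2} =
        {z | z.1.1.1 ∈ z.2.1} ∩ {z | z.1.1.2 ∈ z.2.1} := by
      ext ⟨x, L⟩
      constructor
      · intro h
        have h' : j x = L := h
        exact h' ▸ hj x
      · rintro ⟨h1, h2⟩
        exact Subtype.ext ((hjoin _ _ x.2).unique ⟨(j x).2, hj x⟩ ⟨L.2, h1, h2⟩)
    rw [this]
    exact (hF.preimage (f := fun z : {x : P × P // x.1 ≠ x.2} × 𝓚 => (z.1.1.1, z.2))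
      (by fun_prop)).inter (hF.preimage
        (f := fun z : {x : P × P // x.1 ≠ x.2} × 𝓚 => (z.1.1.2, z.2)) (by fun_prop))
  · convert isOpen_ne_fun (continuous_fst (X := 𝓚) (Y := 𝓚)) continuous_snd using 1
    ext x
    exact ⟨fun h => h.1, fun h => ⟨h, hmeet _ x.1.2 _ x.2.2⟩⟩
  · have hm : ∀ x : {x : 𝓚 × 𝓚 // x.1 ≠ x.2 ∧ (x.1.1 ∩ x.2.1).Nonempty},
      ∃ p, p ∈ x.1.1.1 ∧ p ∈ x.1.2.1 := fun x => x.2.2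
    choose m hm using hm
    refine ⟨m, continuous_of_isClosed_graph_of_compactSpace ?_, hm⟩
    have : {z : {x : 𝓚 × 𝓚 // x.1 ≠ x.2 ∧ (x.1.1 ∩ x.2.1).Nonempty} × P | m z.1 = z.2} =
        {z | z.2 ∈ z.1.1.1.1} ∩ {z | z.2 ∈ z.1.1.2.1} := by
      ext ⟨x, p⟩
      constructor
      · intro h
        have h' : m x = p := h
        exact h' ▸ hm x
      · rintro ⟨h1, h2⟩
        by_contra hne
        exact x.2.1 (Subtype.ext ((hjoin _ _ hne).unique ⟨x.1.1.2, (hm x).1, h1⟩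
          ⟨x.1.2.2, (hm x).2, h2⟩))
    rw [this]
    exact (hF.preimage (f := fun z :
      {x : 𝓚 × 𝓚 // x.1 ≠ x.2 ∧ (x.1.1 ∩ x.2.1).Nonempty} × P => (z.2, z.1.1.1))
      (by fun_prop)).inter (hF.preimage (f := fun z :
      {x : 𝓚 × 𝓚 // x.1 ≠ x.2 ∧ (x.1.1 ∩ x.2.1).Nonempty} × P => (z.2, z.1.1.2)) (by fun_prop))

/-! ### Planes whose nonprojective lines are pairwise disjoint -/

section Coaffine

variable {M : Type u} [TopologicalSpace M] {𝓛 : Set (Set M)} [TopologicalSpace 𝓛]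

/-- A stable plane that is not projective and whose nonprojective lines are pairwise disjoint. -/
structure HasDisjointNonprojectiveLines (𝓛 : Set (Set M)) [TopologicalSpace 𝓛] : Prop where
  stable : IsStablePlane 𝓛
  eq_of_inter : ∀ K L : 𝓛, ¬ IsProjectiveLine 𝓛 K.1 → ¬ IsProjectiveLine 𝓛 L.1 →
    (K.1 ∩ L.1).Nonempty → K = L
  exists_nonprojective : ∃ A : 𝓛, ¬ IsProjectiveLine 𝓛 A.1

/-- Two points of a set that lie in a common connected subset of it. -/
def IsLinkedIn {X : Type*} [TopologicalSpace X] (S : Set X) (x y : X) : Prop :=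
  ∃ C ⊆ S, IsPreconnected C ∧ x ∈ C ∧ y ∈ C

theorem isPreconnected_of_isLinkedIn {X : Type*} [TopologicalSpace X] {S : Set X} {x : X}
    (H : ∀ y ∈ S, IsLinkedIn S x y) : IsPreconnected S :=
  isPreconnected_of_forall x fun y hy =>
    let ⟨C, hCS, hC, hx, hy⟩ := H y hy
    ⟨C, hCS, hx, hy, hC⟩

theorem IsProjectiveLine.inter_nonempty {M : Type u} {𝓛 : Set (Set M)} {K L : 𝓛} (hK : IsProjectiveLine 𝓛 K.1) (hKL : K ≠ L) :
    (K.1 ∩ L.1).Nonempty :=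
  hK L.1 L.2 fun e => hKL (Subtype.ext e.symm)

namespace IsStablePlane

theorem image_join_of_isProjectiveLine (h : IsStablePlane 𝓛) {W : 𝓛}
    (hW : IsProjectiveLine 𝓛 W.1) {c : M} (hc : c ∉ W.1) :
    h.join c '' W.1 = {L : 𝓛 | c ∈ L.1} := by
  ext L
  constructor
  · rintro ⟨x, hx, rfl⟩
    exact h.left_mem_join (ne_of_mem_of_not_mem hx hc).symm
  · intro hL
    obtain ⟨x, hxW, hxL⟩ := hW.inter_nonempty (L := L) fun e => hc (e ▸ hL)
    exact ⟨x, hxW, h.join_eq (ne_of_mem_of_not_mem hxW hc).symm hL hxL⟩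

theorem continuousOn_meet_pencil (h : IsStablePlane 𝓛) {W : 𝓛}
    (hW : IsProjectiveLine 𝓛 W.1) {c : M} (hc : c ∉ W.1) :
    ContinuousOn (fun L => h.meet L W) {L : 𝓛 | c ∈ L.1} :=
  (h.continuousOn_meet_right W).mono fun L hL => by
    have hLW : L ≠ W := fun e => hc (e ▸ hL)
    exact ⟨hLW, inter_comm W.1 L.1 ▸ hW.inter_nonempty hLW.symm⟩

theorem meet_mem_of_isProjectiveLine (h : IsStablePlane 𝓛) {W L : 𝓛}
    (hW : IsProjectiveLine 𝓛 W.1) (hLW : L ≠ W) : h.meet L W ∈ L.1 ∧ h.meet L W ∈ W.1 := by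
  obtain ⟨x, hxW, hxL⟩ := hW.inter_nonempty hLW.symm
  rw [h.meet_eq hLW hxL hxW]
  exact ⟨hxL, hxW⟩

theorem image_meet_pencil (h : IsStablePlane 𝓛) {W : 𝓛}
    (hW : IsProjectiveLine 𝓛 W.1) {c : M} (hc : c ∉ W.1) :
    (fun L => h.meet L W) '' {L : 𝓛 | c ∈ L.1} = W.1 := by
  ext x
  constructor
  · rintro ⟨L, hL, rfl⟩
    exact (h.meet_mem_of_isProjectiveLine hW fun e => hc (e ▸ hL)).2
  · intro hx
    have hcx : c ≠ x := (ne_of_mem_of_not_mem hx hc).symm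
    refine ⟨h.join c x, h.left_mem_join hcx, h.meet_eq ?_ (h.right_mem_join hcx) hx⟩
    exact fun e => hc (e ▸ h.left_mem_join hcx)

/-- Projection from a centre onto a projective line preserves connectedness. -/
theorem isLinkedIn_of_projection (h : IsStablePlane 𝓛) {W : 𝓛} (hW : IsProjectiveLine 𝓛 W.1)
    {c : M} (hc : c ∉ W.1) {S : Set M} (hcS : c ∉ S) {u v : M} (huv : IsLinkedIn S u v) {K L : 𝓛}
    (hcK : c ∈ K.1) (huK : u ∈ K.1) (hcL : c ∈ L.1) (hvL : v ∈ L.1) {u' v' : M} (huK' : u' ∈ K.1)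
    (huW : u' ∈ W.1) (hvL' : v' ∈ L.1) (hvW : v' ∈ W.1) : IsLinkedIn W.1 u' v' := by
  obtain ⟨C, hCS, hC, huC, hvC⟩ := huv
  have hne : ∀ x ∈ C, c ≠ x := fun x hx e => hcS (hCS (e ▸ hx))
  have hmaps : MapsTo (h.join c) C {L : 𝓛 | c ∈ L.1} := fun x hx => h.left_mem_join (hne x hx)
  have hcont : ContinuousOn (fun x => h.meet (h.join c x) W) C :=
    (h.continuousOn_meet_pencil hW hc).comp
      ((h.continuousOn_join_left c).mono fun x hx => (hne x hx).symm) hmaps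
  refine ⟨_, ?_, hC.image _ hcont, ⟨u, huC, ?_⟩, ⟨v, hvC, ?_⟩⟩
  · rintro _ ⟨x, hx, rfl⟩
    exact (h.meet_mem_of_isProjectiveLine hW fun e => hc (e ▸ hmaps hx)).2
  · simp only [h.join_eq (hne u huC) hcK huK]
    exact h.meet_eq (K := K) (L := W) (fun e => hc (e ▸ hcK)) huK' huW
  · simp only [h.join_eq (hne v hvC) hcL hvL]
    exact h.meet_eq (K := L) (L := W) (fun e => hc (e ▸ hcL)) hvL' hvW

theorem join_injOn (h : IsStablePlane 𝓛) {L : 𝓛} {x : M} (hx : x ∉ L.1) :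
    InjOn (h.join x) L.1 := by
  intro a ha b hb hab
  have hxa : x ≠ a := (ne_of_mem_of_not_mem ha hx).symm
  have hxb : x ≠ b := (ne_of_mem_of_not_mem hb hx).symm
  have hne : h.join x a ≠ L := fun e => hx (e ▸ h.left_mem_join hxa)
  exact h.point_eq_of_mem hne (h.right_mem_join hxa) (hab ▸ h.right_mem_join hxb) ha hb

theorem inter_subsingleton (h : IsStablePlane 𝓛) {K L : 𝓛} (hKL : K ≠ L) :
    (K.1 ∩ L.1).Subsingleton :=
  fun _ hx _ hy => h.point_eq_of_mem hKL hx.1 hy.1 hx.2 hy.2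

end IsStablePlane

namespace HasDisjointNonprojectiveLines

theorem isProjectiveLine_of_mem (hd : HasDisjointNonprojectiveLines 𝓛) {A L : 𝓛}
    (hA : ¬ IsProjectiveLine 𝓛 A.1) (hLA : L ≠ A) {x : M} (hxL : x ∈ L.1) (hxA : x ∈ A.1) :
    IsProjectiveLine 𝓛 L.1 :=
  by_contra fun hL => hLA (hd.eq_of_inter L A hL hA ⟨x, hxL, hxA⟩)

theorem exists_disjoint (_hd : HasDisjointNonprojectiveLines 𝓛) {A : 𝓛}
    (hA : ¬ IsProjectiveLine 𝓛 A.1) : ∃ B : 𝓛, ¬ IsProjectiveLine 𝓛 B.1 ∧ Disjoint A.1 B.1 := by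
  have hA' := hA
  simp only [IsProjectiveLine, not_forall] at hA'
  obtain ⟨B, hB, hBA, hAB⟩ := hA'
  refine ⟨⟨B, hB⟩, fun hBp => ?_, disjoint_iff_inter_eq_empty.2 (not_nonempty_iff_eq_empty.1 hAB)⟩
  exact hAB (inter_comm B A.1 ▸ hBp A.1 A.2 hBA.symm)

theorem exists_nonprojective_notMem (hd : HasDisjointNonprojectiveLines 𝓛) (x : M) :
    ∃ A : 𝓛, ¬ IsProjectiveLine 𝓛 A.1 ∧ x ∉ A.1 := by
  obtain ⟨A, hA⟩ := hd.exists_nonprojective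
  obtain ⟨B, hB, hAB⟩ := hd.exists_disjoint hA
  by_cases hx : x ∈ A.1
  · exact ⟨B, hB, fun h => disjoint_left.1 hAB hx h⟩
  · exact ⟨A, hA, hx⟩

theorem isProjectiveLine_join (hd : HasDisjointNonprojectiveLines 𝓛) {A : 𝓛}
    (hA : ¬ IsProjectiveLine 𝓛 A.1) {x a : M} (hx : x ∉ A.1) (ha : a ∈ A.1) :
    IsProjectiveLine 𝓛 (hd.stable.join x a).1 := by
  have hxa : x ≠ a := (ne_of_mem_of_not_mem ha hx).symm
  exact hd.isProjectiveLine_of_mem hA (fun e => hx (e ▸ hd.stable.left_mem_join hxa))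
    (hd.stable.right_mem_join hxa) ha

theorem exists_two_projective (hd : HasDisjointNonprojectiveLines 𝓛) (x : M) :
    ∃ K L : 𝓛, IsProjectiveLine 𝓛 K.1 ∧ IsProjectiveLine 𝓛 L.1 ∧ K ≠ L ∧ x ∈ K.1 ∧ x ∈ L.1 := by
  obtain ⟨A, hA, hx⟩ := hd.exists_nonprojective_notMem x
  obtain ⟨a, ha, b, hb, hab⟩ := hd.stable.nontrivial_line A.1 A.2
  exact ⟨_, _, hd.isProjectiveLine_join hA hx ha, hd.isProjectiveLine_join hA hx hb,
    fun e => hab (hd.stable.join_injOn hx ha hb e),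
    hd.stable.left_mem_join (ne_of_mem_of_not_mem ha hx).symm,
    hd.stable.left_mem_join (ne_of_mem_of_not_mem hb hx).symm⟩

theorem exists_projective_mem_ne (hd : HasDisjointNonprojectiveLines 𝓛) (x : M) (L : 𝓛) :
    ∃ K : 𝓛, IsProjectiveLine 𝓛 K.1 ∧ x ∈ K.1 ∧ K ≠ L := by
  obtain ⟨K, K', hK, hK', hne, hxK, hxK'⟩ := hd.exists_two_projective x
  by_cases e : K = L
  · exact ⟨K', hK', hxK', fun e' => hne (e.trans e'.symm)⟩
  · exact ⟨K, hK, hxK, e⟩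

theorem exists_projective_notMem (hd : HasDisjointNonprojectiveLines 𝓛) (o : M) :
    ∃ W : 𝓛, IsProjectiveLine 𝓛 W.1 ∧ o ∉ W.1 := by
  obtain ⟨A, -, ho⟩ := hd.exists_nonprojective_notMem o
  obtain ⟨x, hx, hxo⟩ := hd.stable.exists_mem_ne A o
  obtain ⟨W, hW, hxW, hne⟩ := hd.exists_projective_mem_ne x (hd.stable.join x o)
  exact ⟨W, hW, fun h => hne (hd.stable.join_eq hxo hxW h).symm⟩

/-- A small connected set `D` at `x` is projected to a projective line. The centre must avoid both
`D` and the line `xz` of two points of `D`, so that the images of `x` and `z` differ. -/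
theorem exists_linked_pair (hd : HasDisjointNonprojectiveLines 𝓛) :
    ∃ (W : 𝓛) (u v : M), IsProjectiveLine 𝓛 W.1 ∧ u ∈ W.1 ∧ v ∈ W.1 ∧ u ≠ v ∧
      IsLinkedIn W.1 u v := by
  have h := hd.stable
  have := h.t2_points
  have := h.locallyCompact_points
  obtain ⟨C, hC, x, hx, y, hy, hxy⟩ :=
    (smallInductiveDimension_pos_iff_exists M).1 h.dim_points_pos
  obtain ⟨K₁, K₂, -, -, hK, hx₁, hx₂⟩ := hd.exists_two_projective x
  obtain ⟨p₁, hp₁, hpx₁⟩ := h.exists_mem_ne K₁ x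
  obtain ⟨p₂, hp₂, hpx₂⟩ := h.exists_mem_ne K₂ x
  obtain ⟨D, hDU, hD, hxD, hDn⟩ := hC.exists_nontrivial_subset hx hy hxy
    (U := ({p₁, p₂} : Set M)ᶜ) (Set.toFinite _).isClosed.isOpen_compl (by
      simp [hpx₁.symm, hpx₂.symm])
  obtain ⟨z, hzD, hzx⟩ := hDn.exists_ne x
  -- The line `xz` cannot contain both `p₁` and `p₂`, since it would then equal both `K₁` and `K₂`.
  have key : ∃ p, p ∉ D ∧ p ∉ (h.join x z).1 := by
    by_cases h1 : p₁ ∈ (h.join x z).1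
    · refine ⟨p₂, fun hp => hDU hp (by simp), fun h2 => hK ?_⟩
      rw [h.eq_of_mem hpx₁ hp₁ hx₁ h1 (h.left_mem_join hzx.symm),
        h.eq_of_mem hpx₂ hp₂ hx₂ h2 (h.left_mem_join hzx.symm)]
    · exact ⟨p₁, fun hp => hDU hp (by simp), h1⟩
  obtain ⟨p, hpD, hp⟩ := key
  obtain ⟨W, hW, hpW⟩ := hd.exists_projective_notMem p
  have hpx : p ≠ x := (ne_of_mem_of_not_mem hxD hpD).symm
  have hpz : p ≠ z := (ne_of_mem_of_not_mem hzD hpD).symm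
  have mx := h.meet_mem_of_isProjectiveLine hW (L := h.join p x)
    fun e => hpW (e ▸ h.left_mem_join hpx)
  have mz := h.meet_mem_of_isProjectiveLine hW (L := h.join p z)
    fun e => hpW (e ▸ h.left_mem_join hpz)
  refine ⟨W, _, _, hW, mx.2, mz.2, fun e => hp ?_,
    h.isLinkedIn_of_projection hW hpW hpD ⟨D, Subset.rfl, hD, hxD, hzD⟩ (h.left_mem_join hpx)
      (h.right_mem_join hpx) (h.left_mem_join hpz) (h.right_mem_join hpz) mx.1 mx.2 mz.1 mz.2⟩
  have hjoin : h.join p x = h.join p z :=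
    h.eq_of_mem (ne_of_mem_of_not_mem mx.2 hpW).symm (h.left_mem_join hpx) mx.1
      (h.left_mem_join hpz) (e ▸ mz.1)
  rw [h.join_eq hzx.symm (h.right_mem_join hpx) (hjoin ▸ h.right_mem_join hpz)]
  exact h.left_mem_join hpx

/-- The line carrying a linked pair is infinite. Projection passes this to every nonprojective line,
then through a pencil to every projective line. Infinite lines leave room to choose centres of
projection. -/
theorem infinite_line (hd : HasDisjointNonprojectiveLines 𝓛) (L : 𝓛) : L.1.Infinite := by
  have h := hd.stable
  have := h.t2_points
  obtain ⟨W, u, v, hW, huW, hvW, huv, C, hCW, hC, huC, hvC⟩ := hd.exists_linked_pair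
  have hWinf : W.1.Infinite :=
    (hC.infinite_of_nontrivial ⟨u, huC, v, hvC, huv⟩).mono hCW
  have hcoaff : ∀ A : 𝓛, ¬ IsProjectiveLine 𝓛 A.1 → A.1.Infinite := by
    intro A hA
    obtain ⟨B, hB, hAB⟩ := hd.exists_disjoint hA
    have hBW : B ≠ W := fun e => hB (e ▸ hW)
    obtain ⟨b, hbB, hbW⟩ : ∃ b ∈ B.1, b ∉ W.1 := by
      by_contra! H
      exact (h.nontrivial_line B.1 B.2).not_subsingleton
        ((h.inter_subsingleton hBW).anti fun x hx => ⟨hx, H x hx⟩)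
    have hbA : b ∉ A.1 := fun hb => disjoint_left.1 hAB hb hbB
    -- The point of `W` on `B`, if any, is dropped: its join with `b` is `B`, which misses `A`.
    have hinf : (W.1 \ B.1).Infinite := by
      have := hWinf.sdiff (h.inter_subsingleton hBW).finite
      refine this.mono fun x hx => ⟨hx.1, fun hxB => hx.2 ⟨hxB, hx.1⟩⟩
    refine infinite_of_injOn_mapsTo (f := fun x => h.meet (h.join b x) A) ?_ ?_ hinf
    · intro x hx y hy hxy
      have hp : ∀ z ∈ W.1 \ B.1, b ≠ z ∧ h.join b z ≠ A ∧ h.meet (h.join b z) A ∈ A.1 ∧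
          h.meet (h.join b z) A ∈ (h.join b z).1 := by
        intro z hz
        have hbz : b ≠ z := (ne_of_mem_of_not_mem hz.1 hbW).symm
        have hne : h.join b z ≠ A := fun e => hbA (e ▸ h.left_mem_join hbz)
        have hproj : IsProjectiveLine 𝓛 (h.join b z).1 :=
          hd.isProjectiveLine_of_mem hB (fun e => hz.2 (e ▸ h.right_mem_join hbz))
            (h.left_mem_join hbz) hbB
        obtain ⟨t, ht1, ht2⟩ := hproj.inter_nonempty hne
        rw [h.meet_eq hne ht1 ht2]
        exact ⟨hbz, hne, ht2, ht1⟩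
      obtain ⟨hbx, -, hx2, hx3⟩ := hp x hx
      obtain ⟨hby, -, hy2, hy3⟩ := hp y hy
      refine h.join_injOn hbW hx.1 hy.1 (h.eq_of_mem (ne_of_mem_of_not_mem hx2 hbA).symm
        (h.left_mem_join hbx) hx3 (h.left_mem_join hby) ?_)
      simp only at hxy
      exact hxy ▸ hy3
    · intro z hz
      have hbz : b ≠ z := (ne_of_mem_of_not_mem hz.1 hbW).symm
      have hne : h.join b z ≠ A := fun e => hbA (e ▸ h.left_mem_join hbz)
      have hproj : IsProjectiveLine 𝓛 (h.join b z).1 :=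
        hd.isProjectiveLine_of_mem hB (fun e => hz.2 (e ▸ h.right_mem_join hbz))
          (h.left_mem_join hbz) hbB
      obtain ⟨t, ht1, ht2⟩ := hproj.inter_nonempty hne
      simp only [h.meet_eq hne ht1 ht2]
      exact ht2
  by_cases hL : IsProjectiveLine 𝓛 L.1
  · obtain ⟨A, hA⟩ := hd.exists_nonprojective
    have hAL : A ≠ L := fun e => hA (e ▸ hL)
    obtain ⟨a, haA, haL⟩ : ∃ a ∈ A.1, a ∉ L.1 := by
      by_contra! H
      exact (h.nontrivial_line A.1 A.2).not_subsingleton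
        ((h.inter_subsingleton hAL).anti fun x hx => ⟨hx, H x hx⟩)
    obtain ⟨B, hB, hAB⟩ := hd.exists_disjoint hA
    have haB : a ∉ B.1 := fun hb => disjoint_left.1 hAB haA hb
    have hpen : {K : 𝓛 | a ∈ K.1}.Infinite :=
      infinite_of_injOn_mapsTo (h.join_injOn haB)
        (fun b hb => h.left_mem_join (ne_of_mem_of_not_mem hb haB).symm) (hcoaff B hB)
    rw [← h.image_join_of_isProjectiveLine hL haL] at hpen
    exact hpen.of_image _
  · exact hcoaff L hL

theorem exists_mem_notMem_notMem (hd : HasDisjointNonprojectiveLines 𝓛) {L K K' : 𝓛}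
    (hK : L ≠ K) (hK' : L ≠ K') : ∃ x ∈ L.1, x ∉ K.1 ∧ x ∉ K'.1 := by
  by_contra! H
  refine hd.infinite_line L (((hd.stable.inter_subsingleton hK).finite.union
    (hd.stable.inter_subsingleton hK').finite).subset fun x hx => ?_)
  by_cases hxK : x ∈ K.1
  · exact Or.inl ⟨hx, hxK⟩
  · exact Or.inr ⟨hx, H x hx hxK⟩

/-- Two perspectivities that fix `u` move the linked pair `(u, v)` to `(u, v')` for any other `v'`
on `W`: first onto a second line `W'` through `u`, sending `v` to `y`, then back to `W`, sending `y`
to `v'`. So `W` is connected, and every other projective line is a perspective image of `W`. -/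
theorem isPreconnected_of_isProjectiveLine (hd : HasDisjointNonprojectiveLines 𝓛) {L : 𝓛}
    (hL : IsProjectiveLine 𝓛 L.1) : IsPreconnected L.1 := by
  have h := hd.stable
  obtain ⟨W, u, v, hW, huW, hvW, huv, hlink⟩ := hd.exists_linked_pair
  have hWc : IsPreconnected W.1 := by
    refine isPreconnected_of_isLinkedIn (x := u) fun v' hv' => ?_
    obtain rfl | huv' := eq_or_ne v' u
    · exact ⟨{v'}, by simpa using hv', isPreconnected_singleton, rfl, rfl⟩
    obtain ⟨W', hW', huW', hne⟩ := hd.exists_projective_mem_ne u W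
    obtain ⟨y, hyW', hyu⟩ := h.exists_mem_ne W' u
    have hyW : y ∉ W.1 := fun hy => hyu (h.point_eq_of_mem hne hyW' huW' hy huW)
    -- The centre carrying `t` to `y` (or back) is a third point of the line `ty`, off `W` and `W'`.
    have centre : ∀ t ∈ W.1, t ≠ u → ∃ c, c ∉ W.1 ∧ c ∉ W'.1 ∧ c ∈ (h.join t y).1 := by
      intro t ht htu
      have hty : t ≠ y := ne_of_mem_of_not_mem ht hyW
      have htW' : t ∉ W'.1 := fun h' => htu (h.point_eq_of_mem hne h' huW' ht huW)
      obtain ⟨c, hc, hcW, hcW'⟩ := hd.exists_mem_notMem_notMem (L := h.join t y) (K := W) (K' := W')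
        (fun e => hyW (e ▸ h.right_mem_join hty)) (fun e => htW' (e ▸ h.left_mem_join hty))
      exact ⟨c, hcW, hcW', hc⟩
    have hvy : v ≠ y := ne_of_mem_of_not_mem hvW hyW
    have hvy' : v' ≠ y := ne_of_mem_of_not_mem hv' hyW
    obtain ⟨c, hcW, hcW', hc⟩ := centre v hvW huv.symm
    obtain ⟨c', hcW₂, hcW₂', hc'⟩ := centre v' hv' huv'
    have hcu : c ≠ u := (ne_of_mem_of_not_mem huW hcW).symm
    have hcu' : c' ≠ u := (ne_of_mem_of_not_mem huW hcW₂).symm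
    have step : IsLinkedIn W'.1 u y :=
      h.isLinkedIn_of_projection hW' hcW' hcW hlink (h.left_mem_join hcu) (h.right_mem_join hcu)
        hc (h.left_mem_join hvy) (h.right_mem_join hcu) huW' (h.right_mem_join hvy) hyW'
    exact h.isLinkedIn_of_projection hW hcW₂ hcW₂' step (h.left_mem_join hcu')
      (h.right_mem_join hcu') hc' (h.right_mem_join hvy') (h.right_mem_join hcu') huW
      (h.left_mem_join hvy') hv'
  obtain rfl | hne := eq_or_ne L W
  · exact hWc
  obtain ⟨A, hA⟩ := hd.exists_nonprojective
  obtain ⟨c, -, hcL, hcW⟩ := hd.exists_mem_notMem_notMem (L := A) (K := L) (K' := W)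
    (fun e => hA (e ▸ hL)) (fun e => hA (e ▸ hW))
  rw [← h.image_meet_pencil hL hcL, ← h.image_join_of_isProjectiveLine hW hcW]
  refine (hWc.image _ ((h.continuousOn_join_left c).mono fun x hx => ?_)).image _ ?_
  · exact ne_of_mem_of_not_mem hx hcW
  · rw [h.image_join_of_isProjectiveLine hW hcW]
    exact h.continuousOn_meet_pencil hL hcL

theorem isPreconnected_pencil (hd : HasDisjointNonprojectiveLines 𝓛) (o : M) :
    IsPreconnected {L : 𝓛 | o ∈ L.1} := by
  obtain ⟨W, hW, ho⟩ := hd.exists_projective_notMem o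
  rw [← hd.stable.image_join_of_isProjectiveLine hW ho]
  exact (hd.isPreconnected_of_isProjectiveLine hW).image _
    ((hd.stable.continuousOn_join_left o).mono fun x hx => ne_of_mem_of_not_mem hx ho)

/-- A projective line through `o` is connected and meets `W`, which lies outside `N`, so it hits the
compact frontier of `N`. Joining `o` to that frontier gives all lines through `o` except at most one
nonprojective line. -/
theorem isCompact_pencil (hd : HasDisjointNonprojectiveLines 𝓛) (o : M) :
    IsCompact {L : 𝓛 | o ∈ L.1} := by
  have h := hd.stable
  have := h.t2_points
  have := h.t2_lines
  have := h.locallyCompact_points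
  obtain ⟨W, hW, ho⟩ := hd.exists_projective_notMem o
  obtain ⟨N, hN, hNW, hNc⟩ := local_compact_nhds ((h.isClosed_line W).isOpen_compl.mem_nhds ho)
  have hoN : o ∈ interior N := mem_interior_iff_mem_nhds.2 hN
  have hof : o ∉ frontier N := fun h' => h'.2 hoN
  have hfc : IsCompact (frontier N) := hNc.of_isClosed_subset isClosed_frontier
    (frontier_subset_closure.trans hNc.isClosed.closure_subset)
  have himg : IsCompact (h.join o '' frontier N) := hfc.image_of_continuousOn
    ((h.continuousOn_join_left o).mono fun x hx => ne_of_mem_of_not_mem hx hof)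
  have hproj : ∀ L : 𝓛, o ∈ L.1 → IsProjectiveLine 𝓛 L.1 → L ∈ h.join o '' frontier N := by
    intro L hoL hL
    have hLW : L ≠ W := fun e => ho (e ▸ hoL)
    obtain ⟨x, hxL, hxW⟩ := hL.inter_nonempty hLW
    obtain ⟨y, hyL, hyN⟩ := (hd.isPreconnected_of_isProjectiveLine hL).inter_frontier_nonempty_of_mem
      hoL hoN hxL (fun hx => hNW (hNc.isClosed.closure_subset hx) hxW)
    exact ⟨y, hyN, h.join_eq (ne_of_mem_of_not_mem hyN hof).symm hoL hyL⟩
  by_cases hA : ∃ A : 𝓛, ¬ IsProjectiveLine 𝓛 A.1 ∧ o ∈ A.1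
  · obtain ⟨A, hA, hoA⟩ := hA
    refine (himg.union (isCompact_singleton (x := A))).of_isClosed_subset
      (h.isClosed_pencil o) fun L hL => ?_
    obtain rfl | hne := eq_or_ne L A
    · exact Or.inr rfl
    · exact Or.inl (hproj L hL (hd.isProjectiveLine_of_mem hA hne hL hoA))
  · push Not at hA
    exact himg.of_isClosed_subset (h.isClosed_pencil o) fun L hL =>
      hproj L hL (by_contra fun h' => hA L h' hL)

theorem isCompact_of_isProjectiveLine (hd : HasDisjointNonprojectiveLines 𝓛) {L : 𝓛}
    (hL : IsProjectiveLine 𝓛 L.1) : IsCompact L.1 := by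
  obtain ⟨c, hc⟩ := hd.stable.exists_notMem L
  rw [← hd.stable.image_meet_pencil hL hc]
  exact (hd.isCompact_pencil c).image_of_continuousOn (hd.stable.continuousOn_meet_pencil hL hc)

/-- Every line meets the compact line `W`. Near a point of `W`, the lines meeting a small compact
`N` are joins of points of `N` with points of a compact projective line `V` disjoint from `N`;
finitely many such `N` cover `W`. -/
theorem compactSpace_lines (hd : HasDisjointNonprojectiveLines 𝓛) : CompactSpace 𝓛 := by
  have h := hd.stable
  have := h.t2_points
  have := h.t2_lines
  have := h.locallyCompact_points
  obtain ⟨o⟩ : Nonempty M := ⟨h.quadrangle.choose 0⟩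
  obtain ⟨W, hW, -⟩ := hd.exists_projective_notMem o
  obtain ⟨𝓒, h𝓒, hsub⟩ : ∃ 𝓒 : Set 𝓛, IsCompact 𝓒 ∧ ∀ L : 𝓛, (L.1 ∩ W.1).Nonempty → L ∈ 𝓒 := by
    refine (hd.isCompact_of_isProjectiveLine hW).induction_on
      (p := fun s => ∃ 𝓒 : Set 𝓛, IsCompact 𝓒 ∧ ∀ L : 𝓛, (L.1 ∩ s).Nonempty → L ∈ 𝓒) ?_ ?_ ?_ ?_
    · exact ⟨∅, isCompact_empty, by simp⟩
    · rintro s t hst ⟨𝓒, h𝓒, H⟩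
      exact ⟨𝓒, h𝓒, fun L hL => H L (hL.mono (inter_subset_inter_right _ hst))⟩
    · rintro s t ⟨𝓒, h𝓒, H⟩ ⟨𝓒', h𝓒', H'⟩
      refine ⟨𝓒 ∪ 𝓒', h𝓒.union h𝓒', ?_⟩
      rintro L ⟨x, hxL, hx | hx⟩
      · exact Or.inl (H L ⟨x, hxL, hx⟩)
      · exact Or.inr (H' L ⟨x, hxL, hx⟩)
    · intro x _
      obtain ⟨V, hV, hxV⟩ := hd.exists_projective_notMem x
      obtain ⟨N, hN, hNV, hNc⟩ :=
        local_compact_nhds ((h.isClosed_line V).isOpen_compl.mem_nhds hxV)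
      refine ⟨N, mem_nhdsWithin_of_mem_nhds hN, (fun y : M × M => h.join y.1 y.2) '' (N ×ˢ V.1),
        (hNc.prod (hd.isCompact_of_isProjectiveLine hV)).image_of_continuousOn
          (h.continuousOn_join.mono ?_), ?_⟩
      · rintro ⟨y, z⟩ ⟨hy, hz⟩ (rfl : y = z)
        exact hNV hy hz
      · rintro L ⟨y, hyL, hyN⟩
        have hyV : y ∉ V.1 := hNV hyN
        obtain ⟨z, hzV, hzL⟩ := hV.inter_nonempty (L := L) fun e => hyV (e ▸ hyL)
        exact ⟨(y, z), ⟨hyN, hzV⟩,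
          h.join_eq (ne_of_mem_of_not_mem hzV hyV).symm hyL hzL⟩
  refine ⟨h𝓒.of_isClosed_subset isClosed_univ fun L _ => hsub L ?_⟩
  obtain rfl | hne := eq_or_ne L W
  · rw [inter_self]
    exact (h.nontrivial_line L.1 L.2).nonempty
  · rw [inter_comm]
    exact hW.inter_nonempty hne.symm

/-- If all lines through `p` were projective, a nonprojective `B` would be a continuous image of the
compact pencil of `p`. For `q` on a nonprojective `A` disjoint from `B`, the pencil of `q` would
then split into two nonempty disjoint closed sets, `{A}` and the lines joining `q` to `B`,
contradicting its connectedness. -/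
theorem exists_nonprojective_mem (hd : HasDisjointNonprojectiveLines 𝓛) (p : M) :
    ∃ A : 𝓛, ¬ IsProjectiveLine 𝓛 A.1 ∧ p ∈ A.1 := by
  have h := hd.stable
  have := h.t2_lines
  by_contra! H
  have Hp : ∀ L : 𝓛, p ∈ L.1 → IsProjectiveLine 𝓛 L.1 := fun L hL =>
    by_contra fun h' => H L h' hL
  obtain ⟨A, hA⟩ := hd.exists_nonprojective
  obtain ⟨B, hB, hAB⟩ := hd.exists_disjoint hA
  have hmeet : ∀ L : 𝓛, p ∈ L.1 → L ≠ B ∧ (L.1 ∩ B.1).Nonempty := fun L hL =>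
    have hLB : L ≠ B := fun e => hB (e ▸ Hp L hL)
    ⟨hLB, (Hp L hL).inter_nonempty hLB⟩
  have hBc : IsCompact B.1 := by
    have : B.1 = (fun L => h.meet L B) '' {L : 𝓛 | p ∈ L.1} := by
      ext x
      constructor
      · intro hx
        have hpx : p ≠ x := (ne_of_mem_of_not_mem hx (H B hB)).symm
        exact ⟨h.join p x, h.left_mem_join hpx, h.meet_eq
          (hmeet _ (h.left_mem_join hpx)).1 (h.right_mem_join hpx) hx⟩
      · rintro ⟨L, hL, rfl⟩
        obtain ⟨hLB, x, hxL, hxB⟩ := hmeet L hL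
        simp only [h.meet_eq hLB hxL hxB]
        exact hxB
    rw [this]
    exact (hd.isCompact_pencil p).image_of_continuousOn
      ((h.continuousOn_meet_right B).mono fun L hL => hmeet L hL)
  obtain ⟨q, hq⟩ := (h.nontrivial_line A.1 A.2).nonempty
  have hqB : q ∉ B.1 := fun h' => disjoint_left.1 hAB hq h'
  have hne : ∀ x ∈ B.1, q ≠ x := fun x hx => (ne_of_mem_of_not_mem hx hqB).symm
  have hclosed : IsClosed (h.join q '' B.1) := (hBc.image_of_continuousOn
    ((h.continuousOn_join_left q).mono fun x hx => (hne x hx).symm)).isClosed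
  obtain ⟨b, hb⟩ := (h.nontrivial_line B.1 B.2).nonempty
  obtain ⟨L, -, ⟨x, hx, hxL⟩, hLA⟩ := isPreconnected_closed_iff.1 (hd.isPreconnected_pencil q)
    _ {A} hclosed isClosed_singleton (by
      intro L hL
      by_cases hLA : L = A
      · exact Or.inr hLA
      · left
        have hLp := hd.isProjectiveLine_of_mem hA hLA hL hq
        obtain ⟨x, hxL, hxB⟩ := hLp.inter_nonempty (L := B) fun e => hB (e ▸ hLp)
        exact ⟨x, hxB, h.join_eq (hne x hxB) hL hxL⟩)
    ⟨h.join q b, h.left_mem_join (hne b hb), b, hb, rfl⟩ ⟨A, hq, rfl⟩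
  rw [mem_singleton_iff] at hLA
  rw [hLA] at hxL
  exact disjoint_left.1 hAB (hxL ▸ h.right_mem_join (hne x hx)) hx

/-- For a nonprojective `A`, the projective lines are exactly the lines other than `A` that meet
`A`. -/
theorem isOpen_isProjectiveLine (hd : HasDisjointNonprojectiveLines 𝓛) :
    IsOpen {L : 𝓛 | IsProjectiveLine 𝓛 L.1} := by
  obtain ⟨A, hA⟩ := hd.exists_nonprojective
  convert hd.stable.isOpen_meet_domain.preimage (f := fun L : 𝓛 => (L, A)) (by fun_prop) using 1
  ext L
  constructor
  · intro hL
    have hne : L ≠ A := fun e => hA (e ▸ hL)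
    exact ⟨hne, hL.inter_nonempty hne⟩
  · rintro ⟨hne, x, hxL, hxA⟩
    exact hd.isProjectiveLine_of_mem hA hne hxL hxA

/-- The lines close to a projective line lie in a common compact set of points. -/
theorem exists_isCompact_of_isProjectiveLine (hd : HasDisjointNonprojectiveLines 𝓛) {L : 𝓛}
    (hL : IsProjectiveLine 𝓛 L.1) : ∃ 𝓤 ∈ nhds L, ∃ C : Set M, IsCompact C ∧
      ∀ K ∈ 𝓤, IsProjectiveLine 𝓛 K.1 ∧ K.1 ⊆ C := by
  have h := hd.stable
  have := h.t2_lines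
  have := h.locallyCompact_lines
  obtain ⟨c, hc⟩ := h.exists_notMem L
  obtain ⟨𝓤, h𝓤, hsub, h𝓤c⟩ := local_compact_nhds (((hd.isOpen_isProjectiveLine).inter
    (h.isClosed_pencil c).isOpen_compl).mem_nhds ⟨hL, hc⟩)
  have hne : ∀ K ∈ 𝓤, ∀ K' : 𝓛, c ∈ K'.1 → K ≠ K' := fun K hK K' hK' e =>
    (hsub hK).2 (show c ∈ K.1 from e ▸ hK')
  refine ⟨𝓤, h𝓤, (fun x : 𝓛 × 𝓛 => h.meet x.1 x.2) '' (𝓤 ×ˢ {K : 𝓛 | c ∈ K.1}),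
    (h𝓤c.prod (hd.isCompact_pencil c)).image_of_continuousOn (h.continuousOn_meet.mono ?_), ?_⟩
  · rintro ⟨K, K'⟩ ⟨hK, hK'⟩
    have hKK' := hne K hK K' hK'
    exact ⟨hKK', IsProjectiveLine.inter_nonempty (hsub hK).1 hKK'⟩
  · refine fun K hK => ⟨(hsub hK).1, fun x hx => ?_⟩
    have hcx : c ≠ x := (ne_of_mem_of_not_mem hx (hsub hK).2).symm
    exact ⟨(K, h.join c x), ⟨hK, h.left_mem_join hcx⟩,
      h.meet_eq (hne K hK _ (h.left_mem_join hcx)) hx (h.right_mem_join hcx)⟩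

end HasDisjointNonprojectiveLines

end Coaffine

/-! ### Completion by a point at infinity -/

section Extension

/-- The trace of a line of `M` in the one-point extension: the added point lies on the
nonprojective lines. -/
def lineExtension {M : Type u} (𝓛 : Set (Set M)) (L : Set M) : Set (OnePoint M) :=
  {x | x.elim (¬ IsProjectiveLine 𝓛 L) fun p => p ∈ L}

@[simp]
theorem coe_mem_lineExtension {M : Type u} {𝓛 : Set (Set M)} {L : Set M} {p : M} :
    (p : OnePoint M) ∈ lineExtension 𝓛 L ↔ p ∈ L :=
  Iff.rfl

@[simp]
theorem infty_mem_lineExtension {M : Type u} {𝓛 : Set (Set M)} {L : Set M} :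
    OnePoint.infty ∈ lineExtension 𝓛 L ↔ ¬ IsProjectiveLine 𝓛 L :=
  Iff.rfl

theorem lineExtension_injective {M : Type u} (𝓛 : Set (Set M)) :
    Function.Injective fun L : 𝓛 => lineExtension 𝓛 L.1 := by
  intro K L hKL
  refine Subtype.ext (Set.ext fun p => ?_)
  rw [← coe_mem_lineExtension (𝓛 := 𝓛), ← coe_mem_lineExtension (𝓛 := 𝓛) (L := L.1)]
  exact Set.ext_iff.1 hKL p

variable {M : Type u} [TopologicalSpace M] {𝓛 : Set (Set M)} [TopologicalSpace 𝓛]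

namespace HasDisjointNonprojectiveLines

/-- At infinity, lines near a projective line stay projective and inside one compact set, whose
complement is a neighbourhood of the added point. At finite points, closedness is that of incidence
in `M`. -/
theorem isClosed_lineExtension_flags (hd : HasDisjointNonprojectiveLines 𝓛) :
    IsClosed {x : OnePoint M × 𝓛 | x.1 ∈ lineExtension 𝓛 x.2.1} := by
  have h := hd.stable
  have := h.t2_points
  rw [← isOpen_compl_iff, isOpen_iff_mem_nhds]
  rintro ⟨x, L⟩ hx
  simp only [mem_compl_iff, mem_ofPred_eq] at hx
  induction x using OnePoint.rec with
  | infty =>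
    rw [infty_mem_lineExtension, not_not] at hx
    obtain ⟨𝓤, h𝓤, C, hC, H⟩ := hd.exists_isCompact_of_isProjectiveLine hx
    have hnhds : ((↑) '' C : Set (OnePoint M))ᶜ ∈ nhds OnePoint.infty :=
      (OnePoint.isOpen_compl_image_coe.2 ⟨hC.isClosed, hC⟩).mem_nhds (by simp)
    filter_upwards [prod_mem_nhds hnhds h𝓤]
    rintro ⟨y, K⟩ ⟨hy, hK⟩ hyK
    simp only [mem_ofPred_eq] at hyK
    induction y using OnePoint.rec with
    | infty => exact hyK (H K hK).1
    | coe y => exact hy ⟨y, (H K hK).2 hyK, rfl⟩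
  | coe p =>
    rw [coe_mem_lineExtension] at hx
    have hemb : Topology.IsOpenEmbedding (Prod.map ((↑) : M → OnePoint M) (id : 𝓛 → 𝓛)) :=
      OnePoint.isOpenEmbedding_coe.prodMap Topology.IsOpenEmbedding.id
    have hO := (hemb.isOpenMap _ h.isClosed_flags.isOpen_compl).mem_nhds
      (mem_image_of_mem _ (show (p, L) ∈ {x : M × 𝓛 | x.1 ∈ x.2.1}ᶜ from hx))
    filter_upwards [hO]
    rintro _ ⟨⟨y, K⟩, hyK, rfl⟩ hyK'
    exact hyK hyK'

theorem isPuncturedProjectivePlane (hd : HasDisjointNonprojectiveLines 𝓛) :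
    IsPuncturedProjectivePlane 𝓛 := by
  have h := hd.stable
  have := h.t2_points
  have := h.t2_lines
  have := h.locallyCompact_points
  have := h.locallyCompact_lines
  have := hd.compactSpace_lines
  let f' : 𝓛 ≃ range fun L : 𝓛 => lineExtension 𝓛 L.1 :=
    Equiv.ofInjective _ (lineExtension_injective 𝓛)
  -- The extended lines carry the topology of `𝓛`, transported along the bijection.
  let _ : TopologicalSpace (range fun L : 𝓛 => lineExtension 𝓛 L.1) :=
    TopologicalSpace.induced f'.symm inferInstance
  let f : 𝓛 ≃ₜ range fun L : 𝓛 => lineExtension 𝓛 L.1 :=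
    (f'.symm.toHomeomorphOfIsInducing ⟨rfl⟩).symm
  have hf : ∀ L : 𝓛, (f L).1 = lineExtension 𝓛 L.1 := fun L => rfl
  have hf' : ∀ K, K.1 = lineExtension 𝓛 (f.symm K).1 := fun K => by
    rw [← hf, f.apply_symm_apply]
  have : CompactSpace (range fun L : 𝓛 => lineExtension 𝓛 L.1) := f.compactSpace
  have : T2Space (range fun L : 𝓛 => lineExtension 𝓛 L.1) := f.t2Space
  have huniq : ∀ K L : 𝓛, ∀ p q : OnePoint M, p ≠ q → p ∈ lineExtension 𝓛 K.1 →
      q ∈ lineExtension 𝓛 K.1 → p ∈ lineExtension 𝓛 L.1 → q ∈ lineExtension 𝓛 L.1 → K = L := by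
    intro K L p q hpq h1 h2 h3 h4
    induction p using OnePoint.rec with
    | infty =>
      induction q using OnePoint.rec with
      | infty => exact absurd rfl hpq
      | coe q => exact hd.eq_of_inter K L h1 h3 ⟨q, h2, h4⟩
    | coe p =>
      induction q using OnePoint.rec with
      | infty => exact hd.eq_of_inter K L h2 h4 ⟨p, h1, h3⟩
      | coe q => exact h.eq_of_mem (fun e => hpq (congrArg _ e)) h1 h2 h3 h4
  have hex : ∀ p q : OnePoint M, p ≠ q → ∃ L : 𝓛, p ∈ lineExtension 𝓛 L.1 ∧
      q ∈ lineExtension 𝓛 L.1 := by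
    intro p q hpq
    induction p using OnePoint.rec with
    | infty =>
      induction q using OnePoint.rec with
      | infty => exact absurd rfl hpq
      | coe q =>
        obtain ⟨A, hA, hq⟩ := hd.exists_nonprojective_mem q
        exact ⟨A, hA, hq⟩
    | coe p =>
      induction q using OnePoint.rec with
      | infty =>
        obtain ⟨A, hA, hp⟩ := hd.exists_nonprojective_mem p
        exact ⟨A, hp, hA⟩
      | coe q =>
        have hpq' : p ≠ q := fun e => hpq (congrArg _ e)
        exact ⟨_, h.left_mem_join hpq', h.right_mem_join hpq'⟩
  refine ⟨OnePoint M, inferInstance, range fun L : 𝓛 => lineExtension 𝓛 L.1, inferInstance,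
    OnePoint.infty, isProjectivePlane_of_isClosed_flags ?_ ?_ ?_ ?_ ?_ ?_ ?_,
    OnePoint.isOpenEmbedding_coe.toIsEmbedding.toHomeomorph.trans
      (Homeomorph.setCongr (t := {x : OnePoint M | x ≠ OnePoint.infty}) ?_), f, ?_⟩
  · convert hd.isClosed_lineExtension_flags.preimage
      (f := fun x : OnePoint M × (range fun L : 𝓛 => lineExtension 𝓛 L.1) => (x.1, f.symm x.2))
      (by fun_prop) using 1
    ext ⟨x, K⟩
    simp only [mem_ofPred_eq, mem_preimage]
    rw [← hf']
  · rintro _ ⟨L, rfl⟩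
    obtain ⟨a, ha, b, hb, hab⟩ := h.nontrivial_line L.1 L.2
    exact ⟨a, ha, b, hb, fun e => hab (OnePoint.coe_injective e)⟩
  · intro p q hpq
    obtain ⟨L, hp, hq⟩ := hex p q hpq
    refine ⟨_, ⟨⟨L, rfl⟩, hp, hq⟩, ?_⟩
    rintro _ ⟨⟨K, rfl⟩, hp', hq'⟩
    simp only [huniq K L p q hpq hp' hq' hp hq]
  · rintro _ ⟨K, rfl⟩ _ ⟨L, rfl⟩
    by_cases hKL : K = L
    · obtain ⟨a, ha⟩ := (h.nontrivial_line L.1 L.2).nonempty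
      exact ⟨(a : OnePoint M), hKL ▸ ha, ha⟩
    by_cases hK : IsProjectiveLine 𝓛 K.1
    · obtain ⟨x, hx⟩ := hK.inter_nonempty hKL
      exact ⟨(x : OnePoint M), hx⟩
    by_cases hL : IsProjectiveLine 𝓛 L.1
    · obtain ⟨x, hxL, hxK⟩ := hL.inter_nonempty (Ne.symm hKL)
      exact ⟨(x : OnePoint M), hxK, hxL⟩
    exact ⟨OnePoint.infty, hK, hL⟩
  · obtain ⟨C, hC, hC'⟩ := (smallInductiveDimension_pos_iff_exists M).1 h.dim_points_pos
    exact (smallInductiveDimension_pos_iff_exists _).2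
      ⟨_, hC.image _ OnePoint.continuous_coe.continuousOn, hC'.image OnePoint.coe_injective⟩
  · exact smallInductiveDimension_pos_of_homeomorph f h.dim_lines_pos
  · obtain ⟨q, hq, hq'⟩ := h.quadrangle
    refine ⟨fun i => q i, OnePoint.coe_injective.comp hq, ?_⟩
    rintro _ ⟨L, rfl⟩ i j k hij hik hjk
    exact hq' L.1 L.2 i j k hij hik hjk
  · rw [← OnePoint.compl_infty]
    rfl
  · intro p L
    exact Iff.rfl

end HasDisjointNonprojectiveLines

end Extension

/-! ### Points and quadrangles avoiding a given point -/

theorem quadrangle_vecCons {P : Type u} {𝓚 : Set (Set P)} {a b c d : P} (hab : a ≠ b) (hac : a ≠ c)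
    (had : a ≠ d) (hbc : b ≠ c) (hbd : b ≠ d) (hcd : c ≠ d)
    (habc : ∀ L ∈ 𝓚, a ∈ L → b ∈ L → c ∉ L) (habd : ∀ L ∈ 𝓚, a ∈ L → b ∈ L → d ∉ L)
    (hacd : ∀ L ∈ 𝓚, a ∈ L → c ∈ L → d ∉ L) (hbcd : ∀ L ∈ 𝓚, b ∈ L → c ∈ L → d ∉ L) :
    Function.Injective ![a, b, c, d] ∧ ∀ L ∈ 𝓚, ∀ i j k : Fin 4, i ≠ j → i ≠ k → j ≠ k →
      ¬ (![a, b, c, d] i ∈ L ∧ ![a, b, c, d] j ∈ L ∧ ![a, b, c, d] k ∈ L) := by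
  constructor
  · intro i j
    fin_cases i <;> fin_cases j <;>
      simp [hab, hac, had, hbc, hbd, hcd, hab.symm, hac.symm, had.symm, hbc.symm, hbd.symm,
        hcd.symm]
  · intro L hL
    replace habc := habc L hL
    replace habd := habd L hL
    replace hacd := hacd L hL
    replace hbcd := hbcd L hL
    clear hab hac had hbc hbd hcd
    intro i j k hij hik hjk
    fin_cases i <;> fin_cases j <;> fin_cases k <;> simp at hij hik hjk ⊢ <;> tauto

namespace IsProjectivePlane

variable {P : Type u} [TopologicalSpace P] {𝓚 : Set (Set P)} [TopologicalSpace 𝓚]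

theorem meet_mem (h : IsProjectivePlane 𝓚) {K L : 𝓚} (hKL : K ≠ L) :
    h.1.meet K L ∈ K.1 ∧ h.1.meet K L ∈ L.1 := by
  obtain ⟨x, hxK, hxL⟩ := h.2 K.1 K.2 L.1 L.2
  rw [h.1.meet_eq hKL hxK hxL]
  exact ⟨hxK, hxL⟩

/-- Every line has two points different from a given one. -/
theorem exists_mem_mem_ne (h : IsProjectivePlane 𝓚) (o : P) (K : 𝓚) :
    ∃ x ∈ K.1, ∃ y ∈ K.1, x ≠ y ∧ x ≠ o ∧ y ≠ o := by
  obtain ⟨q, hq, hq'⟩ := h.1.quadrangle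
  obtain ⟨i, hi⟩ : ∃ i, q i ∉ K.1 := by
    by_contra! H
    exact hq' K.1 K.2 0 1 2 (by decide) (by decide) (by decide) ⟨H _, H _, H _⟩
  have hqi : ∀ j, j ≠ i → q i ≠ q j := fun j hj e => hj (hq e).symm
  -- The other three quadrangle points are projected from `q i` to three distinct points of `K`, at
  -- most one of which is `o`.
  let x : Fin 4 → P := fun j => h.1.meet (h.1.join (q i) (q j)) K
  have hx : ∀ j, j ≠ i → x j ∈ (h.1.join (q i) (q j)).1 ∧ x j ∈ K.1 := fun j hj =>
    h.meet_mem fun e => hi (e ▸ h.1.left_mem_join (hqi j hj))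
  have hinj : ∀ j k, j ≠ i → k ≠ i → j ≠ k → x j ≠ x k := by
    intro j k hj hk hjk e
    have hxi : q i ≠ x j := (ne_of_mem_of_not_mem (hx j hj).2 hi).symm
    have hl := h.1.eq_of_mem hxi (h.1.left_mem_join (hqi j hj)) (hx j hj).1
      (h.1.left_mem_join (hqi k hk)) (e ▸ (hx k hk).1)
    exact hq' _ (h.1.join (q i) (q j)).2 i j k hj.symm hk.symm hjk
      ⟨h.1.left_mem_join (hqi j hj), h.1.right_mem_join (hqi j hj),
        hl ▸ h.1.right_mem_join (hqi k hk)⟩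
  obtain ⟨j, k, l, hj, hk, hl, hjk, hjl, hkl⟩ : ∃ j k l, j ≠ i ∧ k ≠ i ∧ l ≠ i ∧ j ≠ k ∧ j ≠ l ∧
      k ≠ l := by
    have H : ∀ i : Fin 4, ∃ j k l, j ≠ i ∧ k ≠ i ∧ l ≠ i ∧ j ≠ k ∧ j ≠ l ∧ k ≠ l := by decide
    exact H i
  have h1 := hinj j k hj hk hjk
  have h2 := hinj j l hj hl hjl
  have h3 := hinj k l hk hl hkl
  by_cases ej : x j = o
  · exact ⟨x k, (hx k hk).2, x l, (hx l hl).2, h3, ej ▸ h1.symm, ej ▸ h2.symm⟩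
  by_cases ek : x k = o
  · exact ⟨x j, (hx j hj).2, x l, (hx l hl).2, h2, ej, ek ▸ h3.symm⟩
  exact ⟨x j, (hx j hj).2, x k, (hx k hk).2, h1, ej, ek⟩

/-- There is a quadrangle avoiding a given point. -/
theorem exists_quadrangle_ne (h : IsProjectivePlane 𝓚) (o : P) : ∃ q : Fin 4 → P,
    Function.Injective q ∧ (∀ L ∈ 𝓚, ∀ i j k : Fin 4,
      i ≠ j → i ≠ k → j ≠ k → ¬ (q i ∈ L ∧ q j ∈ L ∧ q k ∈ L)) ∧ ∀ i, q i ≠ o := by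
  obtain ⟨q₀, hq₀, hq₀'⟩ := h.1.quadrangle
  by_cases ho : ∃ i, q₀ i = o
  swap
  · exact ⟨q₀, hq₀, hq₀', not_exists.1 ho⟩
  obtain ⟨i, rfl⟩ := ho
  -- Relabelling makes the point to be avoided `q 0`.
  let σ := Equiv.swap 0 i
  obtain ⟨q, hq, hq', hq0⟩ : ∃ q : Fin 4 → P, Function.Injective q ∧ (∀ L : 𝓚, ∀ i j k : Fin 4,
      i ≠ j → i ≠ k → j ≠ k → q i ∈ L.1 → q j ∈ L.1 → q k ∉ L.1) ∧ q 0 = q₀ i :=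
    ⟨q₀ ∘ σ, hq₀.comp σ.injective, fun L a b c hab hac hbc h1 h2 h3 =>
      hq₀' L.1 L.2 _ _ _ (σ.injective.ne hab) (σ.injective.ne hac) (σ.injective.ne hbc)
        ⟨h1, h2, h3⟩, by simp [σ]⟩
  rw [← hq0]
  have hne : ∀ {i j : Fin 4}, i ≠ j → q i ≠ q j := fun hij => hq.ne hij
  have hl : ∀ {i j : Fin 4}, i ≠ j → q i ∈ (h.1.join (q i) (q j)).1 := fun hij =>
    h.1.left_mem_join (hne hij)
  have hr : ∀ {i j : Fin 4}, i ≠ j → q j ∈ (h.1.join (q i) (q j)).1 := fun hij =>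
    h.1.right_mem_join (hne hij)
  have hoff : ∀ {i j k : Fin 4}, i ≠ j → i ≠ k → j ≠ k → q k ∉ (h.1.join (q i) (q j)).1 :=
    fun hij hik hjk => hq' _ _ _ _ hij hik hjk (hl hij) (hr hij)
  have n01 : (0 : Fin 4) ≠ 1 := by decide
  have n02 : (0 : Fin 4) ≠ 2 := by decide
  have n03 : (0 : Fin 4) ≠ 3 := by decide
  have n12 : (1 : Fin 4) ≠ 2 := by decide
  have n13 : (1 : Fin 4) ≠ 3 := by decide
  have n23 : (2 : Fin 4) ≠ 3 := by decide
  have l1 : h.1.join (q 0) (q 2) ≠ h.1.join (q 1) (q 3) := fun e =>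
    hoff n13 n12 n23.symm (e ▸ hr n02)
  have l2 : h.1.join (q 0) (q 3) ≠ h.1.join (q 1) (q 2) := fun e =>
    hoff n12 n13 n23 (e ▸ hr n03)
  -- `q 2` and `q 3` are kept; the two diagonal points `d = 02 ∩ 13` and `d' = 03 ∩ 12` replace `q
  -- 0` and `q 1`.
  obtain ⟨d, hd1, hd2⟩ : ∃ d, d ∈ (h.1.join (q 0) (q 2)).1 ∧ d ∈ (h.1.join (q 1) (q 3)).1 :=
    ⟨_, h.meet_mem l1⟩
  obtain ⟨d', hd1', hd2'⟩ : ∃ d, d ∈ (h.1.join (q 0) (q 3)).1 ∧ d ∈ (h.1.join (q 1) (q 2)).1 :=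
    ⟨_, h.meet_mem l2⟩
  have d0 : d ≠ q 0 := fun e => hoff n13 n01.symm n03.symm (e ▸ hd2)
  have d2 : d ≠ q 2 := fun e => hoff n13 n12 n23.symm (e ▸ hd2)
  have d3 : d ≠ q 3 := fun e => hoff n02 n03 n23 (e ▸ hd1)
  have d0' : d' ≠ q 0 := fun e => hoff n12 n01.symm n02.symm (e ▸ hd2')
  have d2' : d' ≠ q 2 := fun e => hoff n03 n02 n23.symm (e ▸ hd1')
  have d3' : d' ≠ q 3 := fun e => hoff n12 n13 n23 (e ▸ hd2')
  have dd : d ≠ d' := by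
    rintro rfl
    have l3 : h.1.join (q 0) (q 2) ≠ h.1.join (q 0) (q 3) := fun e =>
      hoff n03 n02 n23.symm (e ▸ hr n02)
    exact d0 (h.1.point_eq_of_mem l3 hd1 (hl n02) hd1' (hl n03))
  have t1 : ∀ L : 𝓚, q 2 ∈ L.1 → q 3 ∈ L.1 → d ∉ L.1 := fun L h2 h3 hd => by
    rw [h.1.eq_of_mem d3 hd h3 hd2 (hr n13)] at h2
    exact hoff n13 n12 n23.symm h2
  have t2 : ∀ L : 𝓚, q 2 ∈ L.1 → q 3 ∈ L.1 → d' ∉ L.1 := fun L h2 h3 hd => by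
    rw [h.1.eq_of_mem d2' hd h2 hd2' (hr n12)] at h3
    exact hoff n12 n13 n23 h3
  have t3 : ∀ L : 𝓚, q 2 ∈ L.1 → d ∈ L.1 → d' ∉ L.1 := fun L h2 hd hd' => by
    rw [h.1.eq_of_mem d2 hd h2 hd1 (hr n02)] at hd'
    have l3 : h.1.join (q 0) (q 2) ≠ h.1.join (q 0) (q 3) := fun e =>
      hoff n03 n02 n23.symm (e ▸ hr n02)
    exact d0' (h.1.point_eq_of_mem l3 hd' (hl n02) hd1' (hl n03))
  have t4 : ∀ L : 𝓚, q 3 ∈ L.1 → d ∈ L.1 → d' ∉ L.1 := fun L h3 hd hd' => by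
    rw [h.1.eq_of_mem d3' hd' h3 hd1' (hr n03)] at hd
    have l3 : h.1.join (q 0) (q 2) ≠ h.1.join (q 0) (q 3) := fun e =>
      hoff n03 n02 n23.symm (e ▸ hr n02)
    exact d0 (h.1.point_eq_of_mem l3 hd1 (hl n02) hd (hl n03))
  have n2 := hne n02.symm
  have n3 := hne n03.symm
  have n4 := hne n23
  obtain ⟨hinj, hquad⟩ := quadrangle_vecCons n4 d2.symm d2'.symm d3.symm d3'.symm dd
    (fun L hL => t1 ⟨L, hL⟩) (fun L hL => t2 ⟨L, hL⟩) (fun L hL => t3 ⟨L, hL⟩)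
    (fun L hL => t4 ⟨L, hL⟩)
  refine ⟨![q 2, q 3, d, d'], hinj, hquad, fun i => ?_⟩
  fin_cases i
  exacts [n2, n3, d0, d0']

/-! ### Deleting a point from a projective plane -/

section Puncture

variable {M : Type u} [TopologicalSpace M] {𝓛 : Set (Set M)} [TopologicalSpace 𝓛]

theorem inter_nonempty_iff_of_puncture {o : P} (e : M ≃ₜ {x : P // x ≠ o}) (f : 𝓛 ≃ₜ 𝓚)
    (he : ∀ (p : M) (L : 𝓛), p ∈ L.1 ↔ (e p).1 ∈ (f L).1) (K L : 𝓛) :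
    (K.1 ∩ L.1).Nonempty ↔ ∃ x, x ≠ o ∧ x ∈ (f K).1 ∧ x ∈ (f L).1 := by
  constructor
  · rintro ⟨p, hK, hL⟩
    exact ⟨e p, (e p).2, (he p K).1 hK, (he p L).1 hL⟩
  · rintro ⟨x, hx, hK, hL⟩
    refine ⟨e.symm ⟨x, hx⟩, (he _ _).2 ?_, (he _ _).2 ?_⟩ <;> simpa

theorem isStablePlane_of_puncture (h : IsProjectivePlane 𝓚) {o : P} (e : M ≃ₜ {x : P // x ≠ o})
    (f : 𝓛 ≃ₜ 𝓚) (he : ∀ (p : M) (L : 𝓛), p ∈ L.1 ↔ (e p).1 ∈ (f L).1) : IsStablePlane 𝓛 := by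
  have := h.1.t2_points
  have := h.1.t2_lines
  have := h.1.locallyCompact_points
  have := h.1.locallyCompact_lines
  have hev : ∀ {p q : M}, p ≠ q → (e p).1 ≠ (e q).1 := fun hpq h' =>
    hpq (e.injective (Subtype.ext h'))
  have hM2 : T2Space M := e.symm.t2Space
  have hL2 : T2Space 𝓛 := f.symm.t2Space
  have hoc : LocallyCompactSpace {x : P // x ≠ o} :=
    (isOpen_compl_singleton (x := o)).locallyCompactSpace
  have hMc : LocallyCompactSpace M := e.isClosedEmbedding.locallyCompactSpace
  have hLc : LocallyCompactSpace 𝓛 := f.isClosedEmbedding.locallyCompactSpace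
  -- Two distinct lines still meet exactly when their intersection point in `P` is not `o`, an open
  -- condition by continuity of meeting.
  have hdom : {x : 𝓛 × 𝓛 | x.1 ≠ x.2 ∧ (x.1.1 ∩ x.2.1).Nonempty} =
      (fun x : 𝓛 × 𝓛 => (f x.1, f x.2)) ⁻¹' ({y : 𝓚 × 𝓚 | y.1 ≠ y.2 ∧ (y.1.1 ∩ y.2.1).Nonempty} ∩
        (fun y : 𝓚 × 𝓚 => h.1.meet y.1 y.2) ⁻¹' {o}ᶜ) := by
    ext ⟨K, L⟩
    constructor
    · rintro ⟨hne, hKL⟩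
      obtain ⟨x, hx, hxK, hxL⟩ := (inter_nonempty_iff_of_puncture e f he K L).1 hKL
      refine ⟨⟨f.injective.ne hne, x, hxK, hxL⟩, ?_⟩
      simp only [mem_preimage, h.1.meet_eq (f.injective.ne hne) hxK hxL]
      exact hx
    · rintro ⟨⟨hne, -⟩, ho⟩
      have hm := h.meet_mem hne
      exact ⟨fun e => hne (congrArg f e),
        (inter_nonempty_iff_of_puncture e f he K L).2 ⟨_, ho, hm⟩⟩
  refine ⟨?_, ?_, hM2, hL2, hMc, hLc, ?_, ?_, ?_, ?_, ?_, ?_⟩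
  · intro L hL
    obtain ⟨x, hx, y, hy, hxy, hxo, hyo⟩ := h.exists_mem_mem_ne o (f ⟨L, hL⟩)
    refine ⟨e.symm ⟨x, hxo⟩, (he _ ⟨L, hL⟩).2 (by simpa), e.symm ⟨y, hyo⟩,
      (he _ ⟨L, hL⟩).2 (by simpa), fun h' => hxy ?_⟩
    exact congrArg Subtype.val (e.symm.injective h')
  · intro p q hpq
    refine ⟨(f.symm (h.1.join (e p) (e q))).1, ⟨Subtype.coe_prop _, ?_, ?_⟩, ?_⟩
    · rw [he, f.apply_symm_apply]
      exact h.1.left_mem_join (hev hpq)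
    · rw [he, f.apply_symm_apply]
      exact h.1.right_mem_join (hev hpq)
    · rintro L ⟨hL, hp, hq⟩
      rw [h.1.join_eq (hev hpq) ((he p ⟨L, hL⟩).1 hp) ((he q ⟨L, hL⟩).1 hq), f.symm_apply_apply]
  · obtain ⟨C, hC, hC'⟩ := (smallInductiveDimension_pos_iff_exists P).1 h.1.dim_points_pos
    obtain ⟨x, hx, hxo⟩ := hC'.exists_ne o
    obtain ⟨y, hy, hyx⟩ := hC'.exists_ne x
    -- A connected set through `o` may fall apart when `o` is removed, so it is first shrunk around
    -- `x ≠ o`.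
    obtain ⟨D, hDU, hD, -, hD'⟩ :=
      hC.exists_nontrivial_subset hx hy hyx.symm (isOpen_compl_singleton (x := o)) hxo
    have himg : ((↑) '' ((↑) ⁻¹' D : Set {x : P // x ≠ o}) : Set P) = D := by
      ext z
      exact ⟨fun ⟨w, hw, hwz⟩ => hwz ▸ hw, fun hz => ⟨⟨z, hDU hz⟩, hz, rfl⟩⟩
    have hind : Topology.IsInducing (Subtype.val : {x : P // x ≠ o} → P) := ⟨rfl⟩
    refine (smallInductiveDimension_pos_iff_exists M).2
      ⟨e.symm '' ((↑) ⁻¹' D), ?_, Set.Nontrivial.image ?_ e.symm.injective⟩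
    · refine IsPreconnected.image ?_ _ e.symm.continuous.continuousOn
      rwa [← hind.isPreconnected_image, himg]
    · rw [← himg] at hD'
      exact nontrivial_of_image _ _ hD'
  · exact smallInductiveDimension_pos_of_homeomorph f.symm h.1.dim_lines_pos
  · obtain ⟨j, hj, hj'⟩ := h.1.continuous_join
    refine ⟨fun x => f.symm (j ⟨((e x.1.1).1, (e x.1.2).1), hev x.2⟩),
      f.symm.continuous.comp (hj.comp (Continuous.subtype_mk (by fun_prop) _)), fun x => ?_⟩
    rw [he, he, f.apply_symm_apply]
    exact hj' ⟨((e x.1.1).1, (e x.1.2).1), hev x.2⟩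
  · rw [hdom]
    exact (h.1.continuousOn_meet.isOpen_inter_preimage h.1.isOpen_meet_domain
      isOpen_compl_singleton).preimage (by fun_prop)
  · have hx : ∀ x : {x : 𝓛 × 𝓛 // x.1 ≠ x.2 ∧ (x.1.1 ∩ x.2.1).Nonempty},
        (f x.1.1, f x.1.2) ∈ {y : 𝓚 × 𝓚 | y.1 ≠ y.2 ∧ (y.1.1 ∩ y.2.1).Nonempty} ∩
        (fun y : 𝓚 × 𝓚 => h.1.meet y.1 y.2) ⁻¹' {o}ᶜ := fun x => by
      have : x.1 ∈ {x : 𝓛 × 𝓛 | x.1 ≠ x.2 ∧ (x.1.1 ∩ x.2.1).Nonempty} := x.2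
      rwa [hdom] at this
    have hcont : Continuous fun x : {x : 𝓛 × 𝓛 // x.1 ≠ x.2 ∧ (x.1.1 ∩ x.2.1).Nonempty} =>
        h.1.meet (f x.1.1) (f x.1.2) :=
      h.1.continuousOn_meet.comp_continuous (f := fun x :
        {x : 𝓛 × 𝓛 // x.1 ≠ x.2 ∧ (x.1.1 ∩ x.2.1).Nonempty} => (f x.1.1, f x.1.2))
        (by fun_prop) fun x => (hx x).1
    refine ⟨fun x => e.symm ⟨h.1.meet (f x.1.1) (f x.1.2), (hx x).2⟩,
      e.symm.continuous.comp (hcont.subtype_mk _), fun x => ?_⟩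
    rw [he, he, e.apply_symm_apply]
    exact h.meet_mem (hx x).1.1
  · obtain ⟨q, hq, hq', hqo⟩ := h.exists_quadrangle_ne o
    refine ⟨fun i => e.symm ⟨q i, hqo i⟩, fun i j hij => hq ?_, ?_⟩
    · exact congrArg Subtype.val (e.symm.injective hij)
    · intro L hL i j k hij hik hjk
      have key : ∀ i, e.symm ⟨q i, hqo i⟩ ∈ L ↔ q i ∈ (f ⟨L, hL⟩).1 := fun i => by
        rw [he _ ⟨L, hL⟩, e.apply_symm_apply]
      simpa only [key] using hq' _ (f ⟨L, hL⟩).2 i j k hij hik hjk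

/-- A line through `o` loses its only common point with any other line through `o`, while a line
missing `o` keeps all its intersections. -/
theorem isProjectiveLine_iff_of_puncture (h : IsProjectivePlane 𝓚) {o : P}
    (e : M ≃ₜ {x : P // x ≠ o}) (f : 𝓛 ≃ₜ 𝓚)
    (he : ∀ (p : M) (L : 𝓛), p ∈ L.1 ↔ (e p).1 ∈ (f L).1) (L : 𝓛) :
    IsProjectiveLine 𝓛 L.1 ↔ o ∉ (f L).1 := by
  constructor
  · intro hL ho
    obtain ⟨p, hp⟩ := h.1.exists_notMem (f L)
    have hop : o ≠ p := ne_of_mem_of_not_mem ho hp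
    have hne : f L ≠ h.1.join o p := fun h' => hp (h' ▸ h.1.right_mem_join hop)
    obtain ⟨x, hx, hxL, hxK⟩ := (inter_nonempty_iff_of_puncture e f he L
      (f.symm (h.1.join o p))).1 (hL.inter_nonempty fun h' => hne (f.symm_apply_eq.1 h'.symm).symm)
    rw [f.apply_symm_apply] at hxK
    exact hx (h.1.point_eq_of_mem hne hxL ho hxK (h.1.left_mem_join hop))
  · intro ho K hK _
    obtain ⟨x, hxL, hxK⟩ := h.2 _ (f L).2 _ (f ⟨K, hK⟩).2
    exact (inter_nonempty_iff_of_puncture e f he L ⟨K, hK⟩).2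
      ⟨x, ne_of_mem_of_not_mem hxL ho, hxL, hxK⟩

theorem isPointwiseCoaffineLine_of_puncture (h : IsProjectivePlane 𝓚) {o : P}
    (e : M ≃ₜ {x : P // x ≠ o}) (f : 𝓛 ≃ₜ 𝓚)
    (he : ∀ (p : M) (L : 𝓛), p ∈ L.1 ↔ (e p).1 ∈ (f L).1) (L : 𝓛) (ho : o ∈ (f L).1) :
    IsPointwiseCoaffineLine 𝓛 L.1 := by
  refine ⟨fun hL => (h.isProjectiveLine_iff_of_puncture e f he L).1 hL ho, fun K hK hKL => ?_⟩
  have hne : f ⟨K, hK⟩ ≠ f L := fun h' => hKL (congrArg Subtype.val (f.injective h'))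
  constructor
  · intro hLK
    obtain ⟨x, hx, hxL, hxK⟩ := (inter_nonempty_iff_of_puncture e f he L ⟨K, hK⟩).1 hLK
    exact (h.isProjectiveLine_iff_of_puncture e f he ⟨K, hK⟩).2 fun hoK =>
      hx (h.1.point_eq_of_mem hne hxK hoK hxL ho)
  · intro hKp
    rw [inter_comm]
    exact hKp L.1 L.2 hKL.symm

end Puncture

end IsProjectivePlane

theorem proposition1p3 {M : Type u} [TopologicalSpace M] (𝓛 : Set (Set M)) [TopologicalSpace 𝓛] :
    (IsStablePlane 𝓛 ∧ ∀ L ∈ 𝓛, IsProjectiveLine 𝓛 L ∨ IsPointwiseCoaffineLine 𝓛 L) ↔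
      (IsProjectivePlane 𝓛 ∨ IsPuncturedProjectivePlane 𝓛) := by
  constructor
  · rintro ⟨h, hL⟩
    by_cases hproj : ∀ L ∈ 𝓛, IsProjectiveLine 𝓛 L
    · refine Or.inl ⟨h, fun K hK L hL => ?_⟩
      obtain rfl | hne := eq_or_ne K L
      · rw [inter_self]
        exact (h.nontrivial_line K hK).nonempty
      · exact hproj K hK L hL hne.symm
    · push Not at hproj
      obtain ⟨A, hA, hA'⟩ := hproj
      refine Or.inr (HasDisjointNonprojectiveLines.isPuncturedProjectivePlane
        ⟨h, fun K L hK hL' hKL => ?_, ⟨A, hA⟩, hA'⟩)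
      by_contra hne
      exact hL' ((((hL K.1 K.2).resolve_left hK).2 L.1 L.2
        fun e => hne (Subtype.ext e.symm)).1 hKL)
  · rintro (h | ⟨P, _, 𝓚, _, o, h, e, f, he⟩)
    · exact ⟨h.1, fun L hL => Or.inl fun K hK _ => h.2 L hL K hK⟩
    · refine ⟨h.isStablePlane_of_puncture e f he, fun L hL => ?_⟩
      by_cases ho : o ∈ (f ⟨L, hL⟩).1
      · exact Or.inr (h.isPointwiseCoaffineLine_of_puncture e f he ⟨L, hL⟩ ho)
      · exact Or.inl ((h.isProjectiveLine_iff_of_puncture e f he ⟨L, hL⟩).2 ho)
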